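/- **Setting.** Let $L,m\ge 1$, $d=Lm$. An $N$-qubit circuit consists of $L$ layers of $m$ blocks; the $k$-th of its $d$ blocks applies a Clifford operation $V_k$ (a product of $H$, $S$, $\mathrm{CNOT}$ and identity gates), then an arbitrary multi-qubit Pauli channel $\mathcal M_k$, then a gate $R_Z(\theta)=e^{-i\theta Z/2}$ on some qubit, then on that qubit the Pauli channel $\mathcal N_P(\rho)=(1-p_X-p_Y-p_Z)\rho+p_XX\rho X+p_YY\rho Y+p_ZZ\rho Z$ with $p_X,p_Y,p_Z\ge 0$. The parameters are correlated layer-wise: the $j$-th rotation of every layer has the same angle $x_j$, for an input $x=(x_1,\dots,x_m)$. Let $\tilde\rho(x)$ be the output state on an arbitrary initial state $\rho_0$, let $O$ be an observable with $\|O\|_\infty\le B$ and $f(x)=\operatorname{Tr}(\tilde\rho(x)O)$. For $\omega\in\{0,\pm1\}^d$ let $\Phi_\omega(x)$ be the product over the $d$ rotations of $1$, $\cos$ or $\sin$ of the angle of the rotation, according as $\omega_k=0,1,-1$, and let $f=\sum_\omega\tilde\alpha_\omega\Phi_\omega$ be the trigonometric expansion in which $\tilde\alpha_\omega$ is obtained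 by replacing each $R_Z(\theta)[\cdot]=D_0+\cos\theta\,D_1+\sin\theta\,D_{-1}$ by $D_{\omega_k}$. Put $\mathfrak C(\Lambda)=\{\omega:\|\omega\|_0\le\Lambda\}$, $h_w(x)=\sum_{\omega\in\mathfrak C(\Lambda)}w_\omega\Phi_\omega(x)$ for $w\in\mathbb R^{\mathfrak C(\Lambda)}$, $p=\min\{p_X,p_Y\}$, $q=1-2(p+p_Z)$, and assume that the Pauli eigenvalues $q_X=1-2(p_Y+p_Z)$, $q_Y=1-2(p_X+p_Z)$ satisfy $q_X+q_Y\ge0$, and $q>0$. **Theorem.** Let $R>0$ with $q(1+R)<1/e$, let $\Lambda\le d$ be an integer with $\Lambda>deq(1+R)$, and $\epsilon=16B^2\left(\frac{deq(1+R)}{\Lambda}\right)^{2\Lambda}$. There is a regularization parameter $\lambda>0$, depending only on $L,m,\Lambda,p_X,p_Y,p_Z,R,B$, such that the following holds for every such circuit, $\rho_0$ and $O$, every probability distribution $\mathbb D$ on $[-R,R]^m$, and every $0<\delta\le 1/2$. Let $x^{(1)},\dots,x^{(n)}$ be independent samples of $\mathbb D$, with $$n\ \ge\ \left(\frac1{q(1+R)}\right)^{4\Lambda}\frac{\log(1/\delta)}9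 ,$$ and let the labels $y^{(i)}$ satisfy $\max_i|y^{(i)}-f(x^{(i)})|\le\epsilon_l$ almost surely, where $\epsilon_l\le\sqrt\epsilon/4$. Then, with probability at least $1-\delta$, every minimizer $\hat w$ of $$\frac1n\sum_{i=1}^n\left(h_w(x^{(i)})-y^{(i)}\right)^2+\lambda\|w\|_2$$ satisfies $$\mathbb E_{x\sim\mathbb D}\,|h_{\hat w}(x)-f(x)|^2\le\epsilon .$$ The same holds for the norm-constrained form of the regression: for every radius $r$ with $\|(\tilde\alpha_\omega)_{\omega\in\mathfrak C(\Lambda)}\|_2\le r\le B\left(de^{2q^2}/\Lambda\right)^{\Lambda/2}$, with probability at least $1-\delta$, every minimizer $\hat w$ of $\frac1n\sum_i(h_w(x^{(i)})-y^{(i)})^2$ over $\|w\|_2\le r$ satisfies this bound. -/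

import Mathlib

open MeasureTheory ProbabilityTheory
open scoped Matrix ComplexOrder

noncomputable section

namespace NoisyPQC

/-- Operators on `N` qubits, in the computational basis. -/
abbrev Op (N : ℕ) : Type := Matrix (Fin N → Fin 2) (Fin N → Fin 2) ℂ

/-! ### Pauli operators and elementary gates -/

/-- The single-qubit Pauli matrices `I, X, Y, Z`, indexed by `0, 1, 2, 3`. -/
def pauli : Fin 4 → Matrix (Fin 2) (Fin 2) ℂ :=
  ![1, !![0, 1; 1, 0], !![0, -Complex.I; Complex.I, 0], !![1, 0; 0, -1]]

/-- The `N`-qubit Pauli string `σ_{P 0} ⊗ ⋯ ⊗ σ_{P (N-1)}`. -/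
def pauliString {N : ℕ} (P : Fin N → Fin 4) : Op N :=
  Matrix.of fun a b => ∏ k, pauli (P k) (a k) (b k)

/-- The single-qubit operator `A` acting on qubit `k`, tensored with the identity elsewhere. -/
def onQubit {N : ℕ} (k : Fin N) (A : Matrix (Fin 2) (Fin 2) ℂ) : Op N :=
  Matrix.of fun a b => if ∀ i, i ≠ k → a i = b i then A (a k) (b k) else 0

/-- The gate set `{H, S, CNOT}`; the identity is the empty list of gates. -/
inductive CliffordGate (N : ℕ) : Type
  | hadamard (k : Fin N) : CliffordGate N
  | phase (k : Fin N) : CliffordGate N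
  | cnot (control target : Fin N) (hne : control ≠ target) : CliffordGate N

/-- The unitary of a Clifford gate. -/
def CliffordGate.toOp {N : ℕ} : CliffordGate N → Op N
  | .hadamard k => onQubit k ((((Real.sqrt 2)⁻¹ : ℝ) : ℂ) • !![1, 1; 1, -1])
  | .phase k => onQubit k !![1, 0; 0, Complex.I]
  | .cnot c t _ => Matrix.of fun a b => if a = Function.update b t (b t + b c) then 1 else 0

/-- The unitary of a Clifford operation, given as a list of gates. -/
def cliffordOp {N : ℕ} (V : List (CliffordGate N)) : Op N := (V.map CliffordGate.toOp).prod

/-- The rotation gate `R_Z(θ) = exp(-i θ Z / 2)`. -/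
def rzGate (θ : ℝ) : Matrix (Fin 2) (Fin 2) ℂ :=
  !![Complex.exp (-(Complex.I * (θ / 2 : ℝ))), 0; 0, Complex.exp (Complex.I * (θ / 2 : ℝ))]

/-! ### Channels -/

/-- The unitary channel `ρ ↦ U ρ U†`. -/
def conj {N : ℕ} (U : Op N) (ρ : Op N) : Op N := U * ρ * Uᴴ

/-- The channel of `R_Z(θ)` on qubit `k`. -/
def rzChannel {N : ℕ} (k : Fin N) (θ : ℝ) (ρ : Op N) : Op N := conj (onQubit k (rzGate θ)) ρ

/-- The single-qubit Pauli channel `𝒩_P(p_X, p_Y, p_Z)` on qubit `k`. -/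
def pauliNoise {N : ℕ} (pX pY pZ : ℝ) (k : Fin N) (ρ : Op N) : Op N :=
  ((1 - pX - pY - pZ : ℝ) : ℂ) • ρ
    + (pX : ℂ) • conj (onQubit k (pauli 1)) ρ
    + (pY : ℂ) • conj (onQubit k (pauli 2)) ρ
    + (pZ : ℂ) • conj (onQubit k (pauli 3)) ρ

/-- The multi-qubit Pauli channel in which the Pauli string `P` occurs with probability `c P`. -/
def multiPauliNoise {N : ℕ} (c : (Fin N → Fin 4) → ℝ) (ρ : Op N) : Op N :=
  ∑ P, (c P : ℂ) • conj (pauliString P) ρ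

/-- The superoperators with `R_Z(θ)[ρ] = D_0[ρ] + cos θ • D_1[ρ] + sin θ • D_{-1}[ρ]`:
on the Pauli basis `I, X, Y, Z` of qubit `k`, `D_0` is the projection onto `{I, Z}`,
`D_1` is the projection onto `{X, Y}`, and `D_{-1}` sends `X ↦ Y`, `Y ↦ -X`, `I, Z ↦ 0`. -/
def trigPart {N : ℕ} (k : Fin N) : SignType → Op N → Op N
  | .zero => fun ρ => (1 / 2 : ℂ) • (ρ + conj (onQubit k (pauli 3)) ρ)
  | .pos => fun ρ => (1 / 2 : ℂ) • (ρ - conj (onQubit k (pauli 3)) ρ)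
  | .neg => fun ρ =>
      (-(Complex.I / 2)) • (onQubit k (pauli 3) * ρ - ρ * onQubit k (pauli 3))

/-! ### Noisy circuits with layer-wise correlated parameters -/

/-- The data of a noisy circuit on `N` qubits with `d` rotation gates: the `k`-th block is the
Clifford operation `V_k`, followed by a multi-qubit Pauli channel, followed by an `R_Z` gate on
qubit `qubit k` (which is followed by a single-qubit Pauli channel). -/
structure Circuit (N d : ℕ) where
  qubit : Fin d → Fin N
  clifford : Fin d → List (CliffordGate N)
  noise : Fin d → (Fin N → Fin 4) → ℝ
  noise_nonneg : ∀ k P, 0 ≤ noise k P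
  noise_sum : ∀ k, ∑ P, noise k P = 1

/-- The evolution of `ρ₀` through the noisy circuit, block `0` first, where the channel of the
`k`-th rotation gate is replaced by the superoperator `G k`. -/
def Circuit.evolve {N d : ℕ} (C : Circuit N d) (pX pY pZ : ℝ) (G : Fin d → Op N → Op N)
    (ρ₀ : Op N) : Op N :=
  (List.finRange d).foldl (fun ρ k =>
    pauliNoise pX pY pZ (C.qubit k)
      (G k (multiPauliNoise (C.noise k) (conj (cliffordOp (C.clifford k)) ρ)))) ρ₀

/-- The noisy state `ρ̃(x)` of a circuit of `L` layers with `m` rotation gates each, so with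
`d = L * m` rotation gates in total. The `j`-th rotation gate of every layer has the angle
`x j` (gate `k` of the circuit is gate `k % m` of layer `k / m`). -/
def Circuit.noisyState {N L m : ℕ} (C : Circuit N (L * m)) (pX pY pZ : ℝ) (ρ₀ : Op N)
    (x : Fin m → ℝ) : Op N :=
  C.evolve pX pY pZ (fun k => rzChannel (C.qubit k) (x k.modNat)) ρ₀

/-- The mean value `Tr(ρ̃(x) O)`. -/
def Circuit.meanValue {N L m : ℕ} (C : Circuit N (L * m)) (pX pY pZ : ℝ) (ρ₀ O : Op N)
    (x : Fin m → ℝ) : ℝ :=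
  (Matrix.trace (C.noisyState pX pY pZ ρ₀ x * O)).re

/-- The coefficient `α̃_ω` of the trigonometric expansion `Tr(ρ̃(x) O) = ∑_ω Φ_ω(x) α̃_ω`:
every rotation gate is replaced by the superoperator that `ω` selects. -/
def Circuit.coeff {N d : ℕ} (C : Circuit N d) (pX pY pZ : ℝ) (ρ₀ O : Op N)
    (ω : Fin d → SignType) : ℝ :=
  (Matrix.trace (C.evolve pX pY pZ (fun k => trigPart (C.qubit k) (ω k)) ρ₀ * O)).re

/-- `ρ` is a quantum state. -/
def IsState {N : ℕ} (ρ : Op N) : Prop := ρ.PosSemidef ∧ ρ.trace = 1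

/-! ### Truncated trigonometric features and ridge regression -/

/-- The factor `1`, `cos θ`, `sin θ` for the frequency `0`, `1`, `-1`. -/
def trigFactor (θ : ℝ) : SignType → ℝ
  | .zero => 1
  | .pos => Real.cos θ
  | .neg => Real.sin θ

/-- The trigonometric monomial `Φ_ω(x)`, `ω ∈ {0, ±1}^d` with `d = L * m`, for layer-wise
correlated parameters. -/
def feature {L m : ℕ} (ω : Fin (L * m) → SignType) (x : Fin m → ℝ) : ℝ :=
  ∏ k, trigFactor (x k.modNat) (ω k)

/-- The truncated frequency set `ℭ(Λ) = {ω ∈ {0, ±1}^d : ‖ω‖₀ ≤ Λ}`. -/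
abbrev Freq (d Λ : ℕ) : Type := {ω : Fin d → SignType // hammingNorm ω ≤ Λ}

/-- The hypothesis `h_w(x) = ⟨Φ_{ℭ(Λ)}(x), w⟩`. -/
def hyp {L m Λ : ℕ} (w : EuclideanSpace ℝ (Freq (L * m) Λ)) (x : Fin m → ℝ) : ℝ :=
  ∑ ω, feature ω.1 x * w ω

/-- The training error `(1/n) ∑ᵢ (h_w(xᵢ) - yᵢ)²`. -/
def trainError {L m Λ n : ℕ} (x : Fin n → Fin m → ℝ) (y : Fin n → ℝ)
    (w : EuclideanSpace ℝ (Freq (L * m) Λ)) : ℝ :=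
  1 / (n : ℝ) * ∑ i, (hyp w (x i) - y i) ^ 2

/-- `w` solves the regression problem with penalty `lam * ‖w‖₂`. -/
def IsPenalizedSolution {L m Λ n : ℕ} (lam : ℝ) (x : Fin n → Fin m → ℝ) (y : Fin n → ℝ)
    (w : EuclideanSpace ℝ (Freq (L * m) Λ)) : Prop :=
  ∀ w' : EuclideanSpace ℝ (Freq (L * m) Λ),
    trainError x y w + lam * ‖w‖ ≤ trainError x y w' + lam * ‖w'‖

/-- `w` solves the regression problem over the ball `‖w‖₂ ≤ lam`. -/
def IsConstrainedSolution {L m Λ n : ℕ} (lam : ℝ) (x : Fin n → Fin m → ℝ) (y : Fin n → ℝ)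
    (w : EuclideanSpace ℝ (Freq (L * m) Λ)) : Prop :=
  ‖w‖ ≤ lam ∧ ∀ w' : EuclideanSpace ℝ (Freq (L * m) Λ),
    ‖w'‖ ≤ lam → trainError x y w ≤ trainError x y w'

/-- The prediction error `𝔼_{x ∼ D} |h_w(x) - f(x)|²`. -/
def predError {L m Λ : ℕ} (D : Measure (Fin m → ℝ)) (f : (Fin m → ℝ) → ℝ)
    (w : EuclideanSpace ℝ (Freq (L * m) Λ)) : ℝ :=
  ∫ x, |hyp w x - f x| ^ 2 ∂D

/-- The Euclidean norm `‖α̃_{ℭ(Λ)}‖₂` of the truncated coefficient vector. -/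
def truncCoeffNorm {N d : ℕ} (C : Circuit N d) (pX pY pZ : ℝ) (ρ₀ O : Op N) (Λ : ℕ) : ℝ :=
  ‖(WithLp.toLp 2 fun ω : Freq d Λ => C.coeff pX pY pZ ρ₀ O ω.1 : EuclideanSpace ℝ (Freq d Λ))‖

/-- The target accuracy `ε = 16 B² (d e q (1+R) / Λ)^{2Λ}`. -/
def targetError (d Λ : ℕ) (q R B : ℝ) : ℝ :=
  16 * B ^ 2 * (d * Real.exp 1 * q * (1 + R) / Λ) ^ (2 * Λ)

end NoisyPQC

end

open NoisyPQC

/-!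
# Learning noisy parametrised circuits from truncated trigonometric features

The target `f x = Tr(ρ̃(x) O)` has the expansion `∑ ω, Φ_ω x * α_ω`, and the proof compares the
regression over the truncated features with the truncated coefficient vector `α`. Write
`a = q (1 + R)` and `η = (d e a / Λ) ^ Λ`, so that `√ε = 4 B η`.

*Damping.* On the range of `D_{±1}`, spanned by `X` and `Y` on the rotated qubit, conjugation by
`Z` is `-1` and conjugation by `Y` is minus conjugation by `X`. The noise therefore acts there as
`(1 - pX - pY - 2 pZ) + (pX - pY) (X · X)`, whose dual has norm at most `q`. All other parts of the
circuit are contractions in the Heisenberg picture. Hence `|α_ω| ≤ B q ^ ‖ω‖₀`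
(`Circuit.abs_coeff_le`) and `|f| ≤ B` (`Circuit.abs_meanValue_le`).

*Truncation.* With `|cos| + |sin| ≤ 1 + R` on the inputs, a Chernoff bound for the frequencies of
norm at least `Λ + 1` gives `|f - h_α| ≤ B η / 2 = √ε / 8`
(`Circuit.abs_meanValue_sub_hyp_truncCoeff_le`). The same bound for the low frequencies gives
`‖Φ‖ ^ 2 ≤ (d e / Λ) ^ Λ` and `‖α‖ ≤ W = B (d e ^ (2 q ^ 2) / Λ) ^ (Λ / 2)`. The training error of
`α` is at most `(1 / 8 + 1 / 4) ^ 2 ε`.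

*Generalization.* The error `h_w - f` is linear in the vector `ψ` that consists of the scaled
features and of `f` itself, so `(h_w - f) ^ 2` is a quadratic form in `ψ`. The supremum over the
unit ball of the true minus the empirical quadratic form has mean at most `sup ‖ψ‖ ^ 2 / √n`, by a
Frobenius norm estimate (`integral_supDev_le`), and concentrates by McDiarmid's inequality
(`hasSubgaussianMGF_of_bounded_differences`). The sample size makes this deviation
`5.75 a ^ (2 Λ) sup ‖ψ‖ ^ 2` (`one_add_sqrt_div_sqrt_le`). Since `q < 1 / e`, the product of the
feature and coefficient norms is at most `0.7 B (d e / Λ) ^ Λ`, and a hypothesis with training error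
`A ε` and norm `ρ W` has prediction error at most `(24 A + 5.26 + 4.3 ρ ^ 2) ε / 16`
(`predError_le_of_supDev_le`).

*Conclusion.* In the constrained form `A = 9 / 64` and `ρ ≤ 1`. In the penalized form with the
penalty `ε / (4 W)`, comparison with `α` gives `A = (25 - 16 ρ) / 64`, hence `ρ ≤ 25 / 16`. In both
cases the bound is at most `ε`.
-/

namespace NoisyPQC

/-! ### Unitarity of the gates -/

section Unitary
variable {N : ℕ}

theorem onQubit_mul (k : Fin N) (A A' : Matrix (Fin 2) (Fin 2) ℂ) :
    onQubit k A * onQubit k A' = onQubit k (A * A') := by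
  ext a b
  simp only [onQubit, Matrix.mul_apply, Matrix.of_apply]
  by_cases h : ∀ i, i ≠ k → a i = b i
  · rw [if_pos h]
    -- the intermediate configurations that contribute differ from `a` at `k` only
    rw [← Finset.sum_subset (Finset.subset_univ
      (Finset.univ.image fun z : Fin 2 => Function.update a k z))]
    · rw [Finset.sum_image]
      · refine Finset.sum_congr rfl fun z _ => ?_
        rw [if_pos, if_pos]
        · simp
        · intro i hi; simp [hi, h i hi]
        · intro i hi; simp [hi]
      · intro z _ z' _ hz
        simpa using congrFun hz k
    · intro c _ hc
      rw [if_neg, zero_mul]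
      intro hac
      refine hc (Finset.mem_image.mpr ⟨c k, Finset.mem_univ _, ?_⟩)
      ext i
      by_cases hi : i = k
      · subst hi; simp
      · simp [hi, hac i hi]
  · rw [if_neg h]
    refine Finset.sum_eq_zero fun c _ => ?_
    by_cases hac : ∀ i, i ≠ k → a i = c i
    · rw [if_neg (fun hcb : ∀ i, i ≠ k → c i = b i => h fun i hi => (hac i hi).trans (hcb i hi)),
        mul_zero]
    · rw [if_neg hac, zero_mul]

theorem onQubit_one (k : Fin N) : onQubit k 1 = (1 : Op N) := by
  ext a b
  simp only [onQubit, Matrix.of_apply, Matrix.one_apply]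
  by_cases h : a = b
  · subst h; simp
  · rw [if_neg h]
    by_cases h' : ∀ i, i ≠ k → a i = b i
    · rw [if_pos h', if_neg]
      intro hk
      exact h (funext fun i => if hi : i = k then hi ▸ hk else h' i hi)
    · rw [if_neg h']

theorem conjTranspose_onQubit (k : Fin N) (A : Matrix (Fin 2) (Fin 2) ℂ) :
    (onQubit k A)ᴴ = onQubit k Aᴴ := by
  ext a b
  simp only [onQubit, Matrix.conjTranspose_apply, Matrix.of_apply, eq_comm (a := a _)]
  split_ifs <;> simp

theorem onQubit_add (k : Fin N) (A A' : Matrix (Fin 2) (Fin 2) ℂ) :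
    onQubit k (A + A') = onQubit k A + onQubit k A' := by
  ext a b
  simp only [onQubit, Matrix.of_apply, Matrix.add_apply]
  split_ifs <;> simp

theorem onQubit_smul (k : Fin N) (c : ℂ) (A : Matrix (Fin 2) (Fin 2) ℂ) :
    onQubit k (c • A) = c • onQubit k A := by
  ext a b
  simp only [onQubit, Matrix.of_apply, Matrix.smul_apply]
  split_ifs <;> simp

theorem conjTranspose_onQubit_mul_self (k : Fin N) {A : Matrix (Fin 2) (Fin 2) ℂ}
    (hA : Aᴴ * A = 1) : (onQubit k A)ᴴ * onQubit k A = 1 := by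
  rw [conjTranspose_onQubit, onQubit_mul, hA, onQubit_one]

theorem conjTranspose_pauli_mul_self (i : Fin 4) : (pauli i)ᴴ * pauli i = 1 := by
  fin_cases i <;> ext a b <;> fin_cases a <;> fin_cases b <;>
    simp [pauli, Matrix.mul_apply, Fin.sum_univ_two]

theorem conjTranspose_rzGate_mul_self (θ : ℝ) : (rzGate θ)ᴴ * rzGate θ = 1 := by
  ext a b
  fin_cases a <;> fin_cases b <;>
    simp [rzGate, Matrix.mul_apply, Fin.sum_univ_two, ← Complex.exp_conj, ← Complex.exp_add,
      Complex.conj_ofNat]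

theorem conjTranspose_pauliString_mul_self (P : Fin N → Fin 4) :
    (pauliString P)ᴴ * pauliString P = 1 := by
  ext a b
  have h : ∀ k, ∑ z : Fin 2, star (pauli (P k) z (a k)) * pauli (P k) z (b k)
      = if a k = b k then 1 else 0 := fun k => by
    have := congrFun (congrFun (conjTranspose_pauli_mul_self (P k)) (a k)) (b k)
    simpa [Matrix.mul_apply, Matrix.one_apply] using this
  simp only [pauliString, Matrix.mul_apply, Matrix.conjTranspose_apply, Matrix.of_apply, star_prod,
    ← Finset.prod_mul_distrib]
  rw [← Fintype.piFinset_univ, ← Finset.prod_univ_sum (fun _ => Finset.univ)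
    (fun k z => star (pauli (P k) z (a k)) * pauli (P k) z (b k))]
  simp only [h, Matrix.one_apply, Finset.prod_ite_zero, Finset.mem_univ, true_imp_iff,
    Finset.prod_const_one, funext_iff]

theorem conjTranspose_toOp_mul_self (g : CliffordGate N) : g.toOpᴴ * g.toOp = 1 := by
  cases g with
  | hadamard k =>
    apply conjTranspose_onQubit_mul_self
    have h : (((√2 : ℝ) : ℂ))⁻¹ * ((√2 : ℝ) : ℂ)⁻¹ = 2⁻¹ := by
      rw [← mul_inv, ← Complex.ofReal_mul, Real.mul_self_sqrt (by norm_num)]; norm_num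
    ext a b
    fin_cases a <;> fin_cases b <;>
      simp [Matrix.mul_apply, Fin.sum_univ_two, h] <;> norm_num
  | phase k =>
    apply conjTranspose_onQubit_mul_self
    ext a b
    fin_cases a <;> fin_cases b <;> simp [Matrix.mul_apply, Fin.sum_univ_two]
  | cnot c t hne =>
    have hinj : Function.Injective
        fun b : Fin N → Fin 2 => Function.update b t (b t + b c) := by
      intro b b' h
      have hoff : ∀ i, i ≠ t → b i = b' i := fun i hi => by
        simpa [hi] using congrFun h i
      have ht : b t + b c = b' t + b' c := by simpa using congrFun h t
      rw [hoff c hne] at ht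
      exact funext fun i => if hi : i = t then hi ▸ add_right_cancel ht else hoff i hi
    ext a b
    simp only [CliffordGate.toOp, Matrix.mul_apply, Matrix.conjTranspose_apply, Matrix.of_apply,
      Matrix.one_apply]
    rw [Finset.sum_eq_single (Function.update b t (b t + b c))]
    · simp only [if_true, mul_one]
      by_cases h : a = b
      · simp [h]
      · rw [if_neg h, if_neg, star_zero]
        exact fun h' => h (hinj h').symm
    · intro z _ hz
      rw [if_neg hz, mul_zero]
    · simp

theorem conjTranspose_cliffordOp_mul_self (V : List (CliffordGate N)) :
    (cliffordOp V)ᴴ * cliffordOp V = 1 := by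
  induction V with
  | nil => simp [cliffordOp]
  | cons g V ih =>
    have : cliffordOp (g :: V) = g.toOp * cliffordOp V := by simp [cliffordOp]
    rw [this, Matrix.conjTranspose_mul, Matrix.mul_assoc, ← Matrix.mul_assoc g.toOpᴴ,
      conjTranspose_toOp_mul_self, Matrix.one_mul, ih]

end Unitary

/-! ### Heisenberg-picture contraction -/

section Dual
open scoped Matrix.Norms.L2Operator
variable {N : ℕ}

/-- The superoperator `G` has a dual with respect to the trace pairing (its Heisenberg picture),
and this dual is bounded by `c` in operator norm. Linearity is not required. -/
def HasDualBound (G : Op N → Op N) (c : ℝ) : Prop :=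
  ∃ G' : Op N → Op N, (∀ ρ O, Matrix.trace (G ρ * O) = Matrix.trace (ρ * G' O)) ∧
    ∀ O, ‖G' O‖ ≤ c * ‖O‖

theorem HasDualBound.mono {G : Op N → Op N} {c c' : ℝ} (h : HasDualBound G c) (hc : c ≤ c') :
    HasDualBound G c' := by
  obtain ⟨G', h1, h2⟩ := h
  exact ⟨G', h1, fun O => (h2 O).trans (by gcongr)⟩

theorem HasDualBound.comp {G H : Op N → Op N} {c c' : ℝ} (hG : HasDualBound G c)
    (hH : HasDualBound H c') (hc' : 0 ≤ c') : HasDualBound (fun ρ => G (H ρ)) (c * c') := by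
  obtain ⟨G', h1, h2⟩ := hG
  obtain ⟨H', h3, h4⟩ := hH
  refine ⟨fun O => H' (G' O), fun ρ O => by rw [h1, h3], fun O => (h4 _).trans ?_⟩
  calc c' * ‖G' O‖ ≤ c' * (c * ‖O‖) := by gcongr; exact h2 O
    _ = c * c' * ‖O‖ := by ring

theorem hasDualBound_id : HasDualBound (fun ρ : Op N => ρ) 1 :=
  ⟨id, fun _ _ => rfl, fun O => by simp⟩

theorem HasDualBound.smul {G : Op N → Op N} {c : ℝ} (h : HasDualBound G c) (z : ℂ) :
    HasDualBound (fun ρ => z • G ρ) (‖z‖ * c) := by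
  obtain ⟨G', h1, h2⟩ := h
  refine ⟨fun O => z • G' O, fun ρ O => by simp [h1], fun O => ?_⟩
  rw [norm_smul, mul_assoc]
  exact mul_le_mul_of_nonneg_left (h2 O) (norm_nonneg z)

theorem HasDualBound.add {G H : Op N → Op N} {c c' : ℝ} (hG : HasDualBound G c)
    (hH : HasDualBound H c') : HasDualBound (fun ρ => G ρ + H ρ) (c + c') := by
  obtain ⟨G', h1, h2⟩ := hG
  obtain ⟨H', h3, h4⟩ := hH
  refine ⟨fun O => G' O + H' O, fun ρ O => by simp [add_mul, mul_add, h1, h3], fun O => ?_⟩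
  calc ‖G' O + H' O‖ ≤ ‖G' O‖ + ‖H' O‖ := norm_add_le _ _
    _ ≤ c * ‖O‖ + c' * ‖O‖ := add_le_add (h2 O) (h4 O)
    _ = (c + c') * ‖O‖ := by ring

theorem HasDualBound.sub {G H : Op N → Op N} {c c' : ℝ} (hG : HasDualBound G c)
    (hH : HasDualBound H c') : HasDualBound (fun ρ => G ρ - H ρ) (c + c') := by
  simpa [sub_eq_add_neg] using hG.add (hH.smul (-1))

theorem hasDualBound_sum {ι : Type*} (s : Finset ι) {G : ι → Op N → Op N} {c : ι → ℝ}
    (h : ∀ i, HasDualBound (G i) (c i)) :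
    HasDualBound (fun ρ => ∑ i ∈ s, G i ρ) (∑ i ∈ s, c i) := by
  classical
  induction s using Finset.induction_on with
  | empty => exact ⟨fun _ => 0, fun _ _ => by simp, fun O => by simp⟩
  | insert a s ha ih => simpa [Finset.sum_insert ha] using (h a).add ih

theorem norm_le_one_of_conjTranspose_mul_self {U : Op N} (hU : Uᴴ * U = 1) : ‖U‖ ≤ 1 := by
  have h : ‖U‖ * ‖U‖ = ‖(1 : Op N)‖ := by rw [← Matrix.l2_opNorm_conjTranspose_mul_self, hU]
  rw [norm_one] at h
  nlinarith [norm_nonneg U]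

theorem hasDualBound_mul_left {A : Op N} (hA : ‖A‖ ≤ 1) : HasDualBound (fun ρ => A * ρ) 1 := by
  refine ⟨fun O => O * A, fun ρ O => ?_, fun O => ?_⟩
  · rw [Matrix.mul_assoc, Matrix.trace_mul_comm, Matrix.mul_assoc]
  · rw [one_mul]
    exact (norm_mul_le _ _).trans (mul_le_of_le_one_right (norm_nonneg _) hA)

theorem hasDualBound_mul_right {A : Op N} (hA : ‖A‖ ≤ 1) : HasDualBound (fun ρ => ρ * A) 1 := by
  refine ⟨fun O => A * O, fun ρ O => by rw [Matrix.mul_assoc], fun O => ?_⟩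
  rw [one_mul]
  exact (norm_mul_le _ _).trans (mul_le_of_le_one_left (norm_nonneg _) hA)

theorem hasDualBound_conj {U : Op N} (hU : Uᴴ * U = 1) : HasDualBound (conj U) 1 := by
  have h := norm_le_one_of_conjTranspose_mul_self hU
  have := (hasDualBound_mul_right (A := Uᴴ) (by rwa [Matrix.l2_opNorm_conjTranspose])).comp
    (hasDualBound_mul_left h) zero_le_one
  rwa [mul_one] at this

theorem hasDualBound_conj_pauli (k : Fin N) (i : Fin 4) :
    HasDualBound (conj (onQubit k (pauli i))) 1 :=
  hasDualBound_conj (conjTranspose_onQubit_mul_self k (conjTranspose_pauli_mul_self i))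

theorem hasDualBound_multiPauliNoise {c : (Fin N → Fin 4) → ℝ} (h0 : ∀ P, 0 ≤ c P)
    (h1 : ∑ P, c P = 1) : HasDualBound (multiPauliNoise c) 1 := by
  have := hasDualBound_sum Finset.univ fun P =>
    (hasDualBound_conj (conjTranspose_pauliString_mul_self P)).smul (c P : ℂ)
  refine this.mono (le_of_eq ?_)
  simp [abs_of_nonneg (h0 _), h1]

theorem hasDualBound_pauliNoise {pX pY pZ : ℝ} (hX : 0 ≤ pX) (hY : 0 ≤ pY) (hZ : 0 ≤ pZ)
    (h : pX + pY + pZ ≤ 1) (k : Fin N) : HasDualBound (pauliNoise pX pY pZ k) 1 := by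
  have := (((hasDualBound_id (N := N)).smul ((1 - pX - pY - pZ : ℝ) : ℂ)).add
    ((hasDualBound_conj_pauli k 1).smul (pX : ℂ))).add
    ((hasDualBound_conj_pauli k 2).smul (pY : ℂ)) |>.add
    ((hasDualBound_conj_pauli k 3).smul (pZ : ℂ))
  refine this.mono (le_of_eq ?_)
  simp only [Complex.norm_real, Real.norm_eq_abs, abs_of_nonneg hX, abs_of_nonneg hY,
    abs_of_nonneg hZ, abs_of_nonneg (show 0 ≤ 1 - pX - pY - pZ by linarith)]
  ring

theorem hasDualBound_trigPart (k : Fin N) (s : SignType) : HasDualBound (trigPart k s) 1 := by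
  have hZ := norm_le_one_of_conjTranspose_mul_self
    (conjTranspose_onQubit_mul_self k (conjTranspose_pauli_mul_self 3))
  cases s with
  | zero =>
    refine ((hasDualBound_id.add (hasDualBound_conj_pauli k 3)).smul (1 / 2)).mono ?_
    norm_num
  | pos =>
    refine ((hasDualBound_id.sub (hasDualBound_conj_pauli k 3)).smul (1 / 2)).mono ?_
    norm_num
  | neg =>
    refine (((hasDualBound_mul_left hZ).sub (hasDualBound_mul_right hZ)).smul
      (-(Complex.I / 2))).mono ?_
    norm_num

theorem conj_mul (U V ρ : Op N) : conj (U * V) ρ = conj U (conj V ρ) := by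
  simp [conj, Matrix.conjTranspose_mul, Matrix.mul_assoc]

theorem conj_smul (U : Op N) (z : ℂ) (ρ : Op N) : conj U (z • ρ) = z • conj U ρ := by
  simp [conj]

theorem conj_add (U ρ ρ' : Op N) : conj U (ρ + ρ') = conj U ρ + conj U ρ' := by
  simp [conj, mul_add, add_mul]

theorem onQubit_pauliZ_mul_self (k : Fin N) :
    onQubit k (pauli 3) * onQubit k (pauli 3) = 1 := by
  rw [onQubit_mul, ← onQubit_one k]
  congr 1
  ext a b
  fin_cases a <;> fin_cases b <;> simp [pauli]

theorem conjTranspose_onQubit_pauliZ (k : Fin N) :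
    (onQubit k (pauli 3))ᴴ = onQubit k (pauli 3) := by
  rw [conjTranspose_onQubit]
  congr 1
  ext a b
  fin_cases a <;> fin_cases b <;> simp [pauli]

/-- The parts `D_{±1}` anticommute with `Z`: their range is spanned by `X` and `Y` on the
qubit. -/
theorem conj_pauliZ_trigPart (k : Fin N) {s : SignType} (hs : s ≠ 0) (ρ : Op N) :
    conj (onQubit k (pauli 3)) (trigPart k s ρ) = -trigPart k s ρ := by
  have hZ := onQubit_pauliZ_mul_self k
  have hZ' := conjTranspose_onQubit_pauliZ k
  have hZZ : ∀ A : Op N, onQubit k (pauli 3) * (onQubit k (pauli 3) * A) = A := fun A => by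
    rw [← Matrix.mul_assoc, hZ, Matrix.one_mul]
  cases s with
  | zero => exact absurd rfl hs
  | pos =>
    simp only [trigPart, conj, hZ', Matrix.mul_smul, Matrix.smul_mul, mul_sub, sub_mul,
      Matrix.mul_assoc, hZ, hZZ, Matrix.mul_one, ← smul_neg, neg_sub]
  | neg =>
    simp only [trigPart, conj, hZ', Matrix.mul_smul, Matrix.smul_mul, mul_sub, sub_mul,
      Matrix.mul_assoc, hZ, hZZ, Matrix.mul_one]
    rw [← smul_neg, neg_sub]

theorem conj_pauliY (k : Fin N) (ρ : Op N) :
    conj (onQubit k (pauli 2)) ρ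
      = conj (onQubit k (pauli 1)) (conj (onQubit k (pauli 3)) ρ) := by
  have h : onQubit k (pauli 2) = Complex.I • (onQubit k (pauli 1) * onQubit k (pauli 3)) := by
    rw [onQubit_mul, ← onQubit_smul]
    congr 1
    ext a b
    fin_cases a <;> fin_cases b <;> simp [pauli]
  rw [h, ← conj_mul]
  simp [conj, smul_smul]

/-- The noise damps the parts `D_{±1}` by `q`. On the range of `D_{±1}`, conjugation by `Z` is
`-1` and conjugation by `Y` is minus conjugation by `X`, so the noise acts there as
`(1 - pX - pY - 2 pZ) + (pX - pY) (X · X)`. -/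
theorem hasDualBound_pauliNoise_trigPart {pX pY pZ : ℝ} (h : pX + pY + 2 * pZ ≤ 1)
    (k : Fin N) {s : SignType} (hs : s ≠ 0) :
    HasDualBound (fun ρ => pauliNoise pX pY pZ k (trigPart k s ρ))
      (1 - 2 * (min pX pY + pZ)) := by
  have hfun : (fun ρ => pauliNoise pX pY pZ k (trigPart k s ρ)) = fun ρ =>
      ((1 - pX - pY - 2 * pZ : ℝ) : ℂ) • trigPart k s ρ
        + ((pX - pY : ℝ) : ℂ) • conj (onQubit k (pauli 1)) (trigPart k s ρ) := by
    ext1 ρ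
    have hY : conj (onQubit k (pauli 2)) (trigPart k s ρ)
        = -conj (onQubit k (pauli 1)) (trigPart k s ρ) := by
      rw [conj_pauliY, conj_pauliZ_trigPart k hs]
      simp [conj]
    rw [pauliNoise, conj_pauliZ_trigPart k hs, hY]
    push_cast
    module
  rw [hfun]
  refine (((hasDualBound_trigPart k s).smul _).add
    (((hasDualBound_conj_pauli k 1).comp (hasDualBound_trigPart k s) zero_le_one).smul _)).mono
    (le_of_eq ?_)
  simp only [Complex.norm_real, Real.norm_eq_abs,
    abs_of_nonneg (show 0 ≤ 1 - pX - pY - 2 * pZ by linarith)]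
  rcases le_total pX pY with hXY | hXY
  · rw [min_eq_left hXY, abs_of_nonpos (by linarith)]; ring
  · rw [min_eq_right hXY, abs_of_nonneg (by linarith)]; ring

theorem hasDualBound_foldl {ι : Type*} (l : List ι) {A : ι → Op N → Op N} {c : ι → ℝ}
    (h : ∀ k, HasDualBound (A k) (c k)) (hc : ∀ k, 0 ≤ c k) :
    HasDualBound (fun ρ => l.foldl (fun ρ k => A k ρ) ρ) (l.map c).prod := by
  induction l with
  | nil => simpa using hasDualBound_id
  | cons k l ih =>
    simpa [mul_comm] using ih.comp (h k) (hc k)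

theorem Circuit.hasDualBound_evolve {d : ℕ} (C : Circuit N d) {pX pY pZ : ℝ}
    {G : Fin d → Op N → Op N} {c : Fin d → ℝ}
    (h : ∀ k, HasDualBound (fun ρ => pauliNoise pX pY pZ (C.qubit k) (G k ρ)) (c k))
    (hc : ∀ k, 0 ≤ c k) : HasDualBound (C.evolve pX pY pZ G) (∏ k, c k) := by
  have hstep : ∀ k, HasDualBound (fun ρ => pauliNoise pX pY pZ (C.qubit k)
      (G k (multiPauliNoise (C.noise k) (conj (cliffordOp (C.clifford k)) ρ)))) (c k) := fun k => by
    have := (h k).comp (((hasDualBound_multiPauliNoise (C.noise_nonneg k) (C.noise_sum k)).comp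
      (hasDualBound_conj (conjTranspose_cliffordOp_mul_self (C.clifford k))) zero_le_one))
      (by norm_num)
    simpa using this
  have := hasDualBound_foldl (List.finRange d) hstep hc
  rwa [← List.ofFn_eq_map, List.prod_ofFn] at this

/-- Writing the state as a sum of rank-one operators makes `Tr(ρ O)` a convex combination of expectation
values of `O` in pure states. -/
theorem IsState.norm_trace_mul_le {ρ : Op N} (hρ : IsState ρ) (O : Op N) :
    ‖Matrix.trace (ρ * O)‖ ≤ ‖O‖ := by
  obtain ⟨hpos, htr⟩ := hρ
  obtain ⟨m, A, rfl⟩ := Matrix.posSemidef_iff_eq_sum_vecMulVec.mp hpos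
  set v : Fin m → EuclideanSpace ℂ (Fin N → Fin 2) := fun i => WithLp.toLp 2 (A i) with hv
  have h1 : Matrix.trace ((∑ i, Matrix.vecMulVec (A i) (star (A i))) * O)
      = ∑ i, inner ℂ (v i) (Matrix.toEuclideanCLM (𝕜 := ℂ) O (v i)) := by
    rw [Finset.sum_mul, Matrix.trace_sum]
    refine Finset.sum_congr rfl fun i _ => ?_
    rw [hv, Matrix.toEuclideanCLM_toLp, EuclideanSpace.inner_toLp_toLp, Matrix.vecMulVec_mul,
      Matrix.trace_vecMulVec, dotProduct_comm, ← Matrix.dotProduct_mulVec,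
      dotProduct_comm]
  have h2 : (1 : ℝ) = ∑ i, ‖v i‖ ^ 2 := by
    have : ((∑ i, ‖v i‖ ^ 2 : ℝ) : ℂ) = 1 := by
      rw [← htr, Matrix.trace_sum, Complex.ofReal_sum]
      refine Finset.sum_congr rfl fun i _ => ?_
      rw [Matrix.trace_vecMulVec, ← EuclideanSpace.inner_toLp_toLp, inner_self_eq_norm_sq_to_K]
      norm_cast
    exact_mod_cast this.symm
  rw [h1]
  calc ‖∑ i, inner ℂ (v i) (Matrix.toEuclideanCLM (𝕜 := ℂ) O (v i))‖
      ≤ ∑ i, ‖O‖ * ‖v i‖ ^ 2 := by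
        refine norm_sum_le_of_le _ fun i _ => (norm_inner_le_norm _ _).trans ?_
        have := (Matrix.toEuclideanCLM (𝕜 := ℂ) O).le_opNorm (v i)
        rw [Matrix.l2_opNorm_toEuclideanCLM] at this
        nlinarith [norm_nonneg (v i)]
    _ = ‖O‖ := by rw [← Finset.mul_sum, ← h2, mul_one]

theorem HasDualBound.abs_re_trace_le {G : Op N → Op N} {c : ℝ} (h : HasDualBound G c)
    {ρ : Op N} (hρ : IsState ρ) (O : Op N) : |(Matrix.trace (G ρ * O)).re| ≤ c * ‖O‖ := by
  obtain ⟨G', h1, h2⟩ := h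
  rw [h1]
  exact (Complex.abs_re_le_norm _).trans ((hρ.norm_trace_mul_le _).trans (h2 O))

theorem Circuit.abs_meanValue_le {L m : ℕ} (C : Circuit N (L * m)) {pX pY pZ : ℝ}
    (hX : 0 ≤ pX) (hY : 0 ≤ pY) (hZ : 0 ≤ pZ) (h : pX + pY + pZ ≤ 1) {ρ₀ O : Op N}
    (hρ : IsState ρ₀) {B : ℝ} (hO : ‖Matrix.toEuclideanCLM (𝕜 := ℂ) O‖ ≤ B) (x : Fin m → ℝ) :
    |C.meanValue pX pY pZ ρ₀ O x| ≤ B := by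
  have := (C.hasDualBound_evolve (pX := pX) (pY := pY) (pZ := pZ)
    (G := fun k => rzChannel (C.qubit k) (x k.modNat)) (c := fun _ => 1) (fun k =>
      ((hasDualBound_pauliNoise hX hY hZ h (C.qubit k)).comp
        (hasDualBound_conj (conjTranspose_onQubit_mul_self (C.qubit k)
          (conjTranspose_rzGate_mul_self (x k.modNat)))) zero_le_one).mono (mul_one 1).le)
    (fun _ => zero_le_one)).abs_re_trace_le hρ O
  rw [Finset.prod_const_one, one_mul] at this
  exact this.trans hO

/-- Every rotation that contributes a nonconstant trigonometric factor damps the coefficient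
by `q`. -/
theorem Circuit.abs_coeff_le {d : ℕ} (C : Circuit N d) {pX pY pZ q : ℝ}
    (hX : 0 ≤ pX) (hY : 0 ≤ pY) (hZ : 0 ≤ pZ) (h : pX + pY + 2 * pZ ≤ 1)
    (hq : q = 1 - 2 * (min pX pY + pZ)) (hq0 : 0 ≤ q) {ρ₀ O : Op N}
    (hρ : IsState ρ₀) {B : ℝ} (hO : ‖Matrix.toEuclideanCLM (𝕜 := ℂ) O‖ ≤ B)
    (ω : Fin d → SignType) :
    |C.coeff pX pY pZ ρ₀ O ω| ≤ B * ∏ k, if ω k = 0 then 1 else q := by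
  have := (C.hasDualBound_evolve (pX := pX) (pY := pY) (pZ := pZ)
    (G := fun k => trigPart (C.qubit k) (ω k)) (c := fun k => if ω k = 0 then 1 else q)
    (fun k => by
      split_ifs with hk
      · simpa using (hasDualBound_pauliNoise hX hY hZ (by linarith) (C.qubit k)).comp
          (hasDualBound_trigPart (C.qubit k) (ω k)) zero_le_one
      · rw [hq]
        exact hasDualBound_pauliNoise_trigPart h (C.qubit k) hk)
    (fun k => by split_ifs <;> [exact zero_le_one; exact hq0])).abs_re_trace_le hρ O
  rw [mul_comm] at this
  refine this.trans (mul_le_mul_of_nonneg_right hO (Finset.prod_nonneg fun k _ => ?_))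
  split_ifs <;> [exact zero_le_one; exact hq0]

end Dual

/-! ### The trigonometric expansion -/

section Expansion
variable {N : ℕ}

theorem rzGate_eq (θ : ℝ) :
    rzGate θ = (Real.cos (θ / 2) : ℂ) • 1 + (-(Complex.I * Real.sin (θ / 2))) • pauli 3 := by
  have h1 : Complex.exp (-(Complex.I * ((θ / 2 : ℝ) : ℂ)))
      = Real.cos (θ / 2) - Real.sin (θ / 2) * Complex.I := by
    rw [mul_comm, ← neg_mul, ← Complex.ofReal_neg, Complex.exp_mul_I, ← Complex.ofReal_cos,
      ← Complex.ofReal_sin]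
    simp [sub_eq_add_neg]
  have h2 : Complex.exp (Complex.I * ((θ / 2 : ℝ) : ℂ))
      = Real.cos (θ / 2) + Real.sin (θ / 2) * Complex.I := by
    rw [mul_comm, Complex.exp_mul_I, ← Complex.ofReal_cos, ← Complex.ofReal_sin]
  rw [rzGate, h1, h2]
  ext a b
  fin_cases a <;> fin_cases b <;> simp [pauli] <;> ring

theorem rzChannel_eq_sum (k : Fin N) (θ : ℝ) (ρ : Op N) :
    rzChannel k θ ρ = ∑ s, (trigFactor θ s : ℂ) • trigPart k s ρ := by
  have hsum : ∑ s, (trigFactor θ s : ℂ) • trigPart k s ρ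
      = trigPart k 0 ρ + (Real.cos θ : ℂ) • trigPart k 1 ρ
        + (Real.sin θ : ℂ) • trigPart k (-1) ρ := by
    rw [show (Finset.univ : Finset SignType) = {0, 1, -1} by decide,
      Finset.sum_insert (by decide), Finset.sum_insert (by decide),
      Finset.sum_singleton, ← add_assoc]
    have h0 : trigFactor θ 0 = 1 := rfl
    have h1 : trigFactor θ 1 = Real.cos θ := rfl
    have h2 : trigFactor θ (-1) = Real.sin θ := rfl
    rw [h0, h1, h2, Complex.ofReal_one, one_smul]
  have h0 : trigPart k 0 ρ = (1 / 2 : ℂ) • (ρ + conj (onQubit k (pauli 3)) ρ) := rfl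
  have h1 : trigPart k 1 ρ = (1 / 2 : ℂ) • (ρ - conj (onQubit k (pauli 3)) ρ) := rfl
  have h2 : trigPart k (-1) ρ =
    (-(Complex.I / 2)) • (onQubit k (pauli 3) * ρ - ρ * onQubit k (pauli 3)) := rfl
  have hc : Real.cos θ = 2 * Real.cos (θ / 2) ^ 2 - 1 := by
    rw [← Real.cos_two_mul]; ring_nf
  have hs : Real.sin θ = 2 * Real.sin (θ / 2) * Real.cos (θ / 2) := by
    rw [← Real.sin_two_mul]; ring_nf
  have hcs : ((Real.sin (θ / 2) : ℝ) : ℂ) ^ 2 = 1 - ((Real.cos (θ / 2) : ℝ) : ℂ) ^ 2 := by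
    rw [← Complex.ofReal_pow, Real.sin_sq]; push_cast; ring
  rw [hsum, h0, h1, h2, hc, hs, rzChannel, rzGate_eq, onQubit_add, onQubit_smul, onQubit_smul,
    onQubit_one]
  generalize ((Real.cos (θ / 2) : ℝ)) = c at *
  generalize ((Real.sin (θ / 2) : ℝ)) = s at *
  simp only [conj, Matrix.conjTranspose_add, Matrix.conjTranspose_smul, Matrix.conjTranspose_one,
    conjTranspose_onQubit_pauliZ, add_mul, mul_add, Matrix.smul_mul, Matrix.mul_smul,
    Matrix.one_mul, Matrix.mul_one, smul_smul, smul_add]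
  simp only [RCLike.star_def, Complex.conj_ofReal, map_neg, map_mul, Complex.conj_I]
  push_cast
  match_scalars
  · ring_nf
  all_goals ring_nf
  all_goals simp [hcs, Complex.I_sq]

theorem foldl_sum_smul {V ι S : Type*} [AddCommGroup V] [Module ℂ V] [Fintype S]
    (T : ι → V →ₗ[ℂ] V) (l : List ι) (c : S → ℂ) (v : S → V) :
    l.foldl (fun v k => T k v) (∑ s, c s • v s) = ∑ s, c s • l.foldl (fun v k => T k v) (v s) := by
  induction l generalizing v with
  | nil => rfl
  | cons k l ih => simp only [List.foldl_cons, map_sum, map_smul, ih]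

/-- Multilinear expansion of a composition of superoperators, each a linear combination. -/
theorem foldl_finRange_eq_sum {V S : Type*} [AddCommGroup V] [Module ℂ V] [Fintype S] :
    ∀ {d : ℕ} (A : Fin d → V → V) (T : Fin d → S → V →ₗ[ℂ] V) (c : Fin d → S → ℂ)
      (_ : ∀ k v, A k v = ∑ s, c k s • T k s v) (v : V),
      (List.finRange d).foldl (fun v k => A k v) v
        = ∑ ω : Fin d → S, (∏ k, c k (ω k)) •
            (List.finRange d).foldl (fun v k => T k (ω k) v) v
  | 0, A, T, c, _, v => by simp
  | d + 1, A, T, c, h, v => by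
    rw [List.finRange_succ, List.foldl_cons, List.foldl_map, h 0,
      foldl_finRange_eq_sum (fun k => A k.succ) (fun k => T k.succ) (fun k => c k.succ)
        (fun k => h k.succ), ← (Fin.consEquiv fun _ => S).sum_comp, Fintype.sum_prod_type_right]
    refine Finset.sum_congr rfl fun ω _ => ?_
    rw [foldl_sum_smul (fun k => T k.succ (ω k)), Finset.smul_sum]
    refine Finset.sum_congr rfl fun s _ => ?_
    simp [Fin.consEquiv, List.foldl_map, Fin.prod_univ_succ, smul_smul, mul_comm]

theorem isLinearMap_conj (U : Op N) : IsLinearMap ℂ (conj U) :=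
  ⟨conj_add U, conj_smul U⟩

theorem isLinearMap_multiPauliNoise (c : (Fin N → Fin 4) → ℝ) :
    IsLinearMap ℂ (multiPauliNoise c) where
  map_add ρ ρ' := by simp [multiPauliNoise, conj_add, Finset.sum_add_distrib]
  map_smul z ρ := by
    simp only [multiPauliNoise, conj_smul, Finset.smul_sum]
    exact Finset.sum_congr rfl fun P _ => smul_comm _ _ _

theorem isLinearMap_pauliNoise (pX pY pZ : ℝ) (k : Fin N) :
    IsLinearMap ℂ (pauliNoise pX pY pZ k) where
  map_add ρ ρ' := by simp only [pauliNoise, conj_add]; module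
  map_smul z ρ := by simp only [pauliNoise, conj_smul]; module

theorem isLinearMap_trigPart (k : Fin N) (s : SignType) : IsLinearMap ℂ (trigPart k s) where
  map_add ρ ρ' := by
    cases s <;> simp only [trigPart, conj_add, mul_add, add_mul] <;> module
  map_smul z ρ := by
    cases s <;> simp only [trigPart, conj_smul, Matrix.mul_smul, Matrix.smul_mul] <;> module

/-- The trigonometric expansion of the noisy mean value. -/
theorem Circuit.meanValue_eq_sum {L m : ℕ} (C : Circuit N (L * m)) (pX pY pZ : ℝ) (ρ₀ O : Op N)
    (x : Fin m → ℝ) :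
    C.meanValue pX pY pZ ρ₀ O x = ∑ ω, feature ω x * C.coeff pX pY pZ ρ₀ O ω := by
  have h := foldl_finRange_eq_sum (fun k ρ => pauliNoise pX pY pZ (C.qubit k)
      (rzChannel (C.qubit k) (x k.modNat)
        (multiPauliNoise (C.noise k) (conj (cliffordOp (C.clifford k)) ρ))))
    (fun k s => (isLinearMap_pauliNoise pX pY pZ (C.qubit k)).mk' _ ∘ₗ
      (isLinearMap_trigPart (C.qubit k) s).mk' _ ∘ₗ
      (isLinearMap_multiPauliNoise (C.noise k)).mk' _ ∘ₗ
      (isLinearMap_conj (cliffordOp (C.clifford k))).mk' _)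
    (fun k s => (trigFactor (x k.modNat) s : ℂ))
    (fun k ρ => by
      rw [rzChannel_eq_sum, ← IsLinearMap.mk'_apply (isLinearMap_pauliNoise pX pY pZ (C.qubit k)),
        map_sum]
      simp only [map_smul]
      rfl) ρ₀
  have h' : C.noisyState pX pY pZ ρ₀ x = ∑ ω : Fin (L * m) → SignType, (feature ω x : ℂ) •
      C.evolve pX pY pZ (fun k => trigPart (C.qubit k) (ω k)) ρ₀ := by
    refine h.trans (Finset.sum_congr rfl fun ω _ => ?_)
    rw [feature, Complex.ofReal_prod]
    rfl
  rw [meanValue, h', Finset.sum_mul, Matrix.trace_sum, Complex.re_sum]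
  refine Finset.sum_congr rfl fun ω _ => ?_
  rw [Matrix.smul_mul, Matrix.trace_smul, smul_eq_mul, Complex.re_ofReal_mul]
  rfl

end Expansion

/-! ### Sums over frequencies -/

section Frequencies
variable {d : ℕ}

theorem sum_signType (c : SignType → ℝ) : ∑ s, c s = c 0 + (c 1 + c (-1)) := by
  rw [show (Finset.univ : Finset SignType) = {0, 1, -1} by decide,
    Finset.sum_insert (by decide), Finset.sum_insert (by decide), Finset.sum_singleton]

theorem prod_ite_eq_pow_hammingNorm (y : ℝ) (ω : Fin d → SignType) :
    (∏ k, if ω k = 0 then 1 else y) = y ^ hammingNorm ω := by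
  rw [Finset.prod_ite, Finset.prod_const_one, one_mul, Finset.prod_const, hammingNorm]

/-- A binomial generating function bound: if every rotation carries the weight `1` for the
frequency `0` and total weight at most `a` for `±1`, the generating function of the sums over the
frequencies of given Hamming norm is at most `exp (d a y)`. -/
theorem sum_pow_hammingNorm_mul_prod_le {g : Fin d → SignType → ℝ} {a y : ℝ}
    (hg : ∀ k s, 0 ≤ g k s) (hg0 : ∀ k, g k 0 = 1) (hga : ∀ k, g k 1 + g k (-1) ≤ a)
    (hy : 0 ≤ y) :
    ∑ ω : Fin d → SignType, y ^ hammingNorm ω * ∏ k, g k (ω k) ≤ Real.exp (d * a * y) := by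
  have h1 : ∑ ω : Fin d → SignType, y ^ hammingNorm ω * ∏ k, g k (ω k)
      = ∏ k, (1 + y * (g k 1 + g k (-1))) := by
    simp only [← prod_ite_eq_pow_hammingNorm, ← Finset.prod_mul_distrib]
    rw [← Fintype.piFinset_univ, ← Finset.prod_univ_sum (fun _ => Finset.univ)
      (fun k s => (if s = 0 then 1 else y) * g k s)]
    refine Finset.prod_congr rfl fun k _ => ?_
    rw [sum_signType]
    simp [hg0, mul_add]
  rw [h1]
  calc ∏ k, (1 + y * (g k 1 + g k (-1))) ≤ ∏ _k : Fin d, Real.exp (a * y) := by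
        refine Finset.prod_le_prod (fun k _ => ?_) fun k _ => ?_
        · have := hg k 1; have := hg k (-1); positivity
        · have := mul_le_mul_of_nonneg_left (hga k) hy
          linarith [Real.add_one_le_exp (a * y)]
    _ = Real.exp (d * a * y) := by
        rw [Finset.prod_const, Finset.card_univ, Fintype.card_fin, ← Real.exp_nat_mul, mul_assoc]

/-- Chernoff bound for the frequencies of Hamming norm at most `Λ ≤ d`. -/
theorem sum_prod_le_of_hammingNorm_le {Λ : ℕ} (hΛ : 1 ≤ Λ) (hΛd : Λ ≤ d)
    {g : Fin d → SignType → ℝ} {a : ℝ}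
    (hg : ∀ k s, 0 ≤ g k s) (hg0 : ∀ k, g k 0 = 1) (hga : ∀ k, g k 1 + g k (-1) ≤ a) :
    ∑ ω : Freq d Λ, ∏ k, g k (ω.1 k) ≤ (d * Real.exp a / Λ) ^ Λ := by
  have hΛ0 : (0 : ℝ) < Λ := by exact_mod_cast hΛ
  have hd0 : (0 : ℝ) < d := by exact_mod_cast hΛ.trans hΛd
  -- a nearly optimal weight in the generating function; `y ≤ 1` makes `y ^ Λ ≤ y ^ ‖ω‖₀`
  set y : ℝ := Λ / d with hy
  have hy0 : 0 < y := by positivity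
  have hy1 : y ≤ 1 := (div_le_one hd0).2 (by exact_mod_cast hΛd)
  have h := sum_pow_hammingNorm_mul_prod_le hg hg0 hga hy0.le
  have h2 : y ^ Λ * ∑ ω : Freq d Λ, ∏ k, g k (ω.1 k) ≤ Real.exp (d * a * y) := by
    refine le_trans ?_ h
    rw [Finset.mul_sum]
    refine le_trans (Finset.sum_le_sum fun ω _ => mul_le_mul_of_nonneg_right
      (pow_le_pow_of_le_one hy0.le hy1 ω.2) (Finset.prod_nonneg fun k _ => hg _ _)) ?_
    rw [← Finset.sum_subtype {ω : Fin d → SignType | hammingNorm ω ≤ Λ} (by simp)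
      fun ω => y ^ hammingNorm ω * ∏ k, g k (ω k)]
    exact Finset.sum_le_sum_of_subset_of_nonneg (Finset.filter_subset _ _) fun ω _ _ =>
      mul_nonneg (by positivity) (Finset.prod_nonneg fun k _ => hg _ _)
  have h3 : Real.exp (d * a * y) = Real.exp a ^ Λ := by
    rw [← Real.exp_nat_mul, hy]; congr 1; field_simp
  rw [h3] at h2
  calc ∑ ω : Freq d Λ, ∏ k, g k (ω.1 k)
      = y⁻¹ ^ Λ * (y ^ Λ * ∑ ω : Freq d Λ, ∏ k, g k (ω.1 k)) := by
        rw [← mul_assoc, ← mul_pow, inv_mul_cancel₀ hy0.ne', one_pow, one_mul]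
    _ ≤ y⁻¹ ^ Λ * Real.exp a ^ Λ := by gcongr
    _ = (d * Real.exp a / Λ) ^ Λ := by rw [← mul_pow, hy, inv_div]; ring_nf

/-- Chernoff bound for the frequencies of Hamming norm greater than `Λ`. -/
theorem sum_prod_le_of_lt_hammingNorm {Λ : ℕ}
    {g : Fin d → SignType → ℝ} {a : ℝ} (ha : 0 < d * a) (haΛ : d * a ≤ Λ + 1)
    (hg : ∀ k s, 0 ≤ g k s) (hg0 : ∀ k, g k 0 = 1) (hga : ∀ k, g k 1 + g k (-1) ≤ a) :
    ∑ ω : Fin d → SignType with Λ < hammingNorm ω, ∏ k, g k (ω k)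
      ≤ (d * a * Real.exp 1 / (Λ + 1)) ^ (Λ + 1) := by
  -- a nearly optimal weight in the generating function; `1 ≤ y` makes `y ^ (Λ + 1) ≤ y ^ ‖ω‖₀`
  set y : ℝ := (Λ + 1) / (d * a) with hy
  have hy0 : 0 < y := by positivity
  have hy1 : 1 ≤ y := (one_le_div ha).2 haΛ
  have h := sum_pow_hammingNorm_mul_prod_le hg hg0 hga hy0.le
  have h2 : y ^ (Λ + 1) * ∑ ω : Fin d → SignType with Λ < hammingNorm ω, ∏ k, g k (ω k)
      ≤ Real.exp (d * a * y) := by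
    refine le_trans ?_ h
    rw [Finset.mul_sum]
    refine le_trans (Finset.sum_le_sum fun ω hω => mul_le_mul_of_nonneg_right
      (pow_le_pow_right₀ hy1 (Finset.mem_filter.1 hω).2) (Finset.prod_nonneg fun k _ => hg _ _)) ?_
    exact Finset.sum_le_sum_of_subset_of_nonneg (Finset.filter_subset _ _) fun ω _ _ =>
      mul_nonneg (by positivity) (Finset.prod_nonneg fun k _ => hg _ _)
  have h3 : Real.exp (d * a * y) = Real.exp 1 ^ (Λ + 1) := by
    rw [← Real.exp_nat_mul, hy, mul_div_cancel₀ _ ha.ne']; push_cast; ring_nf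
  rw [h3] at h2
  calc ∑ ω : Fin d → SignType with Λ < hammingNorm ω, ∏ k, g k (ω k)
      = y⁻¹ ^ (Λ + 1) * (y ^ (Λ + 1) *
          ∑ ω : Fin d → SignType with Λ < hammingNorm ω, ∏ k, g k (ω k)) := by
        rw [← mul_assoc, ← mul_pow, inv_mul_cancel₀ hy0.ne', one_pow, one_mul]
    _ ≤ y⁻¹ ^ (Λ + 1) * Real.exp 1 ^ (Λ + 1) := by gcongr
    _ = (d * a * Real.exp 1 / (Λ + 1)) ^ (Λ + 1) := by rw [← mul_pow, hy, inv_div]; ring_nf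

end Frequencies

/-! ### The truncated expansion -/

section Truncation
variable {N L m Λ : ℕ}

theorem feature_sq_eq_prod (ω : Fin (L * m) → SignType) (x : Fin m → ℝ) :
    feature ω x ^ 2 = ∏ k, trigFactor (x (Fin.modNat k)) (ω k) ^ 2 := by
  rw [feature, Finset.prod_pow]

theorem continuous_feature (ω : Fin (L * m) → SignType) :
    Continuous (feature ω : (Fin m → ℝ) → ℝ) := by
  refine continuous_finsetProd _ fun k _ => ?_
  cases h : ω k
  · exact continuous_const
  · exact Real.continuous_sin.comp (continuous_apply _)
  · exact Real.continuous_cos.comp (continuous_apply _)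

theorem Circuit.continuous_meanValue (C : Circuit N (L * m)) (pX pY pZ : ℝ) (ρ₀ O : Op N) :
    Continuous (C.meanValue pX pY pZ ρ₀ O) := by
  rw [show C.meanValue pX pY pZ ρ₀ O = fun x => ∑ ω, feature ω x * C.coeff pX pY pZ ρ₀ O ω from
    funext (C.meanValue_eq_sum pX pY pZ ρ₀ O)]
  exact continuous_finsetSum _ fun ω _ => (continuous_feature ω).mul continuous_const

/-- The squared norm of the truncated feature vector. -/
theorem sum_feature_sq_le (hΛ : 1 ≤ Λ) (hΛd : Λ ≤ L * m) (x : Fin m → ℝ) :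
    ∑ ω : Freq (L * m) Λ, feature ω.1 x ^ 2 ≤ (((L * m : ℕ) : ℝ) * Real.exp 1 / Λ) ^ Λ := by
  simp only [feature_sq_eq_prod]
  refine sum_prod_le_of_hammingNorm_le hΛ hΛd (g := fun k s => trigFactor (x k.modNat) s ^ 2)
    (fun k s => sq_nonneg _) (fun k => ?_) fun k => ?_
  · exact one_pow 2
  · exact (Real.cos_sq_add_sin_sq _).le

/-- The coefficient vector of the truncated expansion. -/
noncomputable def Circuit.truncCoeff {d : ℕ} (C : Circuit N d) (pX pY pZ : ℝ) (ρ₀ O : Op N)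
    (Λ : ℕ) : EuclideanSpace ℝ (Freq d Λ) :=
  WithLp.toLp 2 fun ω : Freq d Λ => C.coeff pX pY pZ ρ₀ O ω.1

variable {d : ℕ} {pX pY pZ q B : ℝ} {ρ₀ O : Op N}

/-- Damping makes each of the two nonconstant frequencies of a rotation contribute `q ^ 2`. -/
theorem Circuit.truncCoeffNorm_le (C : Circuit N d) (hΛ : 1 ≤ Λ) (hΛd : Λ ≤ d)
    (hX : 0 ≤ pX) (hY : 0 ≤ pY) (hZ : 0 ≤ pZ) (h : pX + pY + 2 * pZ ≤ 1)
    (hq : q = 1 - 2 * (min pX pY + pZ)) (hq0 : 0 ≤ q)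
    (hρ : IsState ρ₀) (hO : ‖Matrix.toEuclideanCLM (𝕜 := ℂ) O‖ ≤ B) :
    truncCoeffNorm C pX pY pZ ρ₀ O Λ ≤ B * √((d * Real.exp (2 * q ^ 2) / Λ) ^ Λ) := by
  have hB : 0 ≤ B := (norm_nonneg _).trans hO
  rw [truncCoeffNorm, EuclideanSpace.norm_eq, ← Real.sqrt_sq hB, ← Real.sqrt_mul (sq_nonneg B)]
  refine Real.sqrt_le_sqrt ?_
  have hle := sum_prod_le_of_hammingNorm_le hΛ hΛd
    (g := fun (_ : Fin d) s => (if s = 0 then (1 : ℝ) else q) ^ 2) (a := 2 * q ^ 2)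
    (fun _ _ => sq_nonneg _) (fun _ => by simp) (fun _ => by simp; linarith)
  refine le_trans ?_ (mul_le_mul_of_nonneg_left hle (sq_nonneg B))
  rw [Finset.mul_sum]
  refine Finset.sum_le_sum fun ω _ => ?_
  rw [Finset.prod_pow, ← mul_pow, Real.norm_eq_abs]
  exact pow_le_pow_left₀ (abs_nonneg _) (C.abs_coeff_le hX hY hZ h hq hq0 hρ hO ω.1) 2

theorem Circuit.meanValue_sub_hyp_truncCoeff (C : Circuit N (L * m)) (x : Fin m → ℝ) :
    C.meanValue pX pY pZ ρ₀ O x - hyp (C.truncCoeff pX pY pZ ρ₀ O Λ) x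
      = ∑ ω : Fin (L * m) → SignType with Λ < hammingNorm ω,
          feature ω x * C.coeff pX pY pZ ρ₀ O ω := by
  rw [C.meanValue_eq_sum, ← Finset.sum_filter_add_sum_filter_not Finset.univ
    (fun ω : Fin (L * m) → SignType => hammingNorm ω ≤ Λ)]
  have : hyp (C.truncCoeff pX pY pZ ρ₀ O Λ) x = ∑ ω : Fin (L * m) → SignType with
      hammingNorm ω ≤ Λ, feature ω x * C.coeff pX pY pZ ρ₀ O ω := by
    rw [hyp, Finset.sum_subtype _ (p := fun ω => hammingNorm ω ≤ Λ) (by simp)]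
    rfl
  rw [this]
  simp only [not_le, add_sub_cancel_left]

/-- On `[-R, R]^m` a rotation contributes `|cos| + |sin| ≤ 1 + R`, which the damping turns into
`q (1 + R)`; the Chernoff bound at the threshold `Λ + 1` gives half of `(d e q (1 + R) / Λ) ^ Λ`. -/
theorem Circuit.abs_meanValue_sub_hyp_truncCoeff_le {R : ℝ} (C : Circuit N (L * m)) (hΛ : 1 ≤ Λ)
    (hX : 0 ≤ pX) (hY : 0 ≤ pY) (hZ : 0 ≤ pZ) (h : pX + pY + 2 * pZ ≤ 1)
    (hq : q = 1 - 2 * (min pX pY + pZ)) (hq0 : 0 < q) (hR : 0 ≤ R)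
    (hd : 0 < L * m) (hdΛ : ((L * m : ℕ) : ℝ) * Real.exp 1 * q * (1 + R) ≤ Λ)
    (hρ : IsState ρ₀) (hO : ‖Matrix.toEuclideanCLM (𝕜 := ℂ) O‖ ≤ B)
    {x : Fin m → ℝ} (hx : ∀ j, x j ∈ Set.Icc (-R) R) :
    |C.meanValue pX pY pZ ρ₀ O x - hyp (C.truncCoeff pX pY pZ ρ₀ O Λ) x|
      ≤ B * (((L * m : ℕ) : ℝ) * Real.exp 1 * q * (1 + R) / Λ) ^ Λ / 2 := by
  have hB : 0 ≤ B := (norm_nonneg _).trans hO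
  have hΛ0 : (0 : ℝ) < Λ := by exact_mod_cast hΛ
  have hd0 : (0 : ℝ) < ((L * m : ℕ) : ℝ) := by exact_mod_cast hd
  set D : ℝ := ((L * m : ℕ) : ℝ) with hD
  have hDa : D * (q * (1 + R)) ≤ Λ := by
    refine le_trans ?_ hdΛ
    have : (1 : ℝ) ≤ Real.exp 1 := Real.one_le_exp zero_le_one
    calc D * (q * (1 + R)) = D * 1 * q * (1 + R) := by ring
      _ ≤ D * Real.exp 1 * q * (1 + R) := by gcongr
  have hle := sum_prod_le_of_lt_hammingNorm (Λ := Λ) (d := L * m)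
    (g := fun k s => |trigFactor (x k.modNat) s| * if s = 0 then (1 : ℝ) else q)
    (a := q * (1 + R)) (by positivity) (by linarith)
    (fun k s => mul_nonneg (abs_nonneg _) (by split_ifs <;> [exact zero_le_one; exact hq0.le]))
    (fun k => by
      have : trigFactor (x k.modNat) 0 = 1 := rfl
      simp [this])
    (fun k => by
      have h1 : trigFactor (x k.modNat) 1 = Real.cos (x k.modNat) := rfl
      have h2 : trigFactor (x k.modNat) (-1) = Real.sin (x k.modNat) := rfl
      have h3 := Real.abs_cos_le_one (x k.modNat)
      have h4 : |Real.sin (x k.modNat)| ≤ R := Real.abs_sin_le_abs.trans (abs_le.2 (hx _))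
      simp only [h1, h2, one_ne_zero, if_false, show ((-1 : SignType) = 0) = False by decide]
      nlinarith)
  rw [C.meanValue_sub_hyp_truncCoeff]
  calc |∑ ω : Fin (L * m) → SignType with Λ < hammingNorm ω,
          feature ω x * C.coeff pX pY pZ ρ₀ O ω|
      ≤ ∑ ω : Fin (L * m) → SignType with Λ < hammingNorm ω,
          B * ∏ k, (|trigFactor (x k.modNat) (ω k)| * if ω k = 0 then (1 : ℝ) else q) := by
        refine (Finset.abs_sum_le_sum_abs _ _).trans (Finset.sum_le_sum fun ω _ => ?_)
        rw [abs_mul, feature, Finset.abs_prod, Finset.prod_mul_distrib, mul_left_comm]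
        exact mul_le_mul_of_nonneg_left (C.abs_coeff_le hX hY hZ h hq hq0.le hρ hO ω)
          (Finset.prod_nonneg fun _ _ => abs_nonneg _)
    _ ≤ B * (D * (q * (1 + R)) * Real.exp 1 / (Λ + 1)) ^ (Λ + 1) := by
        rw [← Finset.mul_sum]; gcongr
    _ ≤ B * ((D * Real.exp 1 * q * (1 + R) / Λ) ^ Λ / 2) := by
        refine mul_le_mul_of_nonneg_left ?_ hB
        set c : ℝ := D * Real.exp 1 * q * (1 + R) with hc
        have hc0 : 0 ≤ c := by positivity
        have e : D * (q * (1 + R)) * Real.exp 1 = c := by rw [hc]; ring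
        -- Bernoulli: `2 Λ ^ Λ ≤ (Λ + 1) ^ Λ`
        have hbern : 2 * (Λ : ℝ) ^ Λ ≤ ((Λ : ℝ) + 1) ^ Λ := by
          have := one_add_mul_le_pow (a := 1 / (Λ : ℝ)) (by
            have : 0 ≤ 1 / (Λ : ℝ) := by positivity
            linarith) Λ
          rw [mul_one_div_cancel hΛ0.ne'] at this
          calc 2 * (Λ : ℝ) ^ Λ ≤ (1 + 1 / (Λ : ℝ)) ^ Λ * (Λ : ℝ) ^ Λ := by gcongr; linarith
            _ = ((Λ : ℝ) + 1) ^ Λ := by rw [← mul_pow]; congr 1; field_simp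
        rw [e, div_pow, div_pow, div_div, div_le_div_iff₀ (by positivity) (by positivity)]
        calc c ^ (Λ + 1) * ((Λ : ℝ) ^ Λ * 2) = c ^ Λ * c * (2 * (Λ : ℝ) ^ Λ) := by ring
          _ ≤ c ^ Λ * (Λ + 1) * ((Λ : ℝ) + 1) ^ Λ := by gcongr; linarith
          _ = c ^ Λ * ((Λ : ℝ) + 1) ^ (Λ + 1) := by ring
    _ = B * (D * Real.exp 1 * q * (1 + R) / Λ) ^ Λ / 2 := by ring

end Truncation

/-! ### McDiarmid's inequality -/

section McDiarmid
variable {E : Type*} [MeasurableSpace E]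

/-- McDiarmid's inequality in moment-generating form: a bounded measurable function of `n`
independent variables that changes by at most `c` when one of them changes is sub-Gaussian with
variance proxy `n (c / 2) ^ 2`. Averaging out one variable at a time reduces it to Hoeffding's
lemma. -/
theorem hasSubgaussianMGF_of_bounded_differences (D : Measure E) [IsProbabilityMeasure D]
    (c : NNReal) {M : ℝ} : ∀ (n : ℕ) (g : (Fin n → E) → ℝ) (_ : Measurable g)
      (_ : ∀ x, |g x| ≤ M) (_ : ∀ x i z, |g (Function.update x i z) - g x| ≤ c),
      HasSubgaussianMGF (fun x => g x - ∫ x', g x' ∂Measure.pi fun _ => D)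
        (n * (c / 2) ^ 2) (Measure.pi fun _ => D)
  | 0, g, _, _, _ => by
    have : (fun x => g x - ∫ x', g x' ∂Measure.pi fun _ : Fin 0 => D) = fun _ => 0 := by
      ext x
      have hg : g = fun _ => g x := funext fun x' => congrArg g (Subsingleton.elim _ _)
      rw [hg]; simp
    rw [this]
    simp
  | n + 1, g, hg, hM, hc => by
    have hne : Nonempty E := D.nonempty_of_neZero
    set P : Measure (Fin n → E) := Measure.pi fun _ => D with hP
    set g₁ : (Fin n → E) → ℝ := fun y => ∫ z, g (Fin.cons z y) ∂D with hg₁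
    have hcons : Measurable fun p : E × (Fin n → E) => (Fin.cons p.1 p.2 : Fin (n + 1) → E) := by
      refine measurable_pi_lambda _ fun i => ?_
      refine Fin.cases ?_ (fun j => ?_) i
      · simpa using measurable_fst
      · simp only [Fin.cons_succ]; fun_prop
    have hgc : Measurable fun p : E × (Fin n → E) => g (Fin.cons p.1 p.2) := hg.comp hcons
    have hgz : ∀ y, Measurable fun z => g (Fin.cons z y) := fun y =>
      hgc.comp (measurable_id.prodMk measurable_const)
    have hint : ∀ y, Integrable (fun z => g (Fin.cons z y)) D := fun y =>
      Integrable.of_bound (hgz y).aestronglyMeasurable M (ae_of_all _ fun z => hM _)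
    have hg₁m : Measurable g₁ := by
      have : StronglyMeasurable fun p : (Fin n → E) × E => g (Fin.cons p.2 p.1) :=
        (hgc.comp measurable_swap).stronglyMeasurable
      exact this.integral_prod_right.measurable
    have hmp : MeasurePreserving (fun p : E × (Fin n → E) => (Fin.cons p.1 p.2 : Fin (n + 1) → E))
        (D.prod P) (Measure.pi fun _ => D) := by
      have := (measurePreserving_piFinSuccAbove (fun _ : Fin (n + 1) => D) 0).symm
      convert this using 1
      ext p i
      simp [MeasurableEquiv.piFinSuccAbove, Fin.insertNthEquiv]
    have hchange : ∀ F : (Fin (n + 1) → E) → ℝ, Measurable F → (∃ A, ∀ x, |F x| ≤ A) →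
        ∫ x, F x ∂(Measure.pi fun _ => D) = ∫ y, ∫ z, F (Fin.cons z y) ∂D ∂P := by
      rintro F hF ⟨A, hA⟩
      rw [← hmp.map_eq, integral_map hmp.measurable.aemeasurable hF.aestronglyMeasurable,
        integral_prod_symm]
      exact Integrable.of_bound (hF.comp hcons).aestronglyMeasurable A (ae_of_all _ fun _ => hA _)
    set I : ℝ := ∫ x', g x' ∂Measure.pi fun _ => D with hI
    have hI₁ : I = ∫ y, g₁ y ∂P := hchange g hg ⟨M, hM⟩
    have ih := hasSubgaussianMGF_of_bounded_differences D c (M := M) n g₁ hg₁m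
      (fun y => by
        have := norm_integral_le_of_norm_le_const (μ := D) (f := fun z => g (Fin.cons z y))
          (ae_of_all _ fun z => hM _)
        simpa using this)
      (fun y i z => by
        have h1 : g₁ (Function.update y i z) - g₁ y
            = ∫ w, (g (Fin.cons w (Function.update y i z)) - g (Fin.cons w y)) ∂D :=
          (integral_sub (hint _) (hint _)).symm
        have := norm_integral_le_of_norm_le_const (μ := D) (C := (c : ℝ))
          (f := fun w => g (Fin.cons w (Function.update y i z)) - g (Fin.cons w y))
          (ae_of_all _ fun w => by
            rw [Fin.cons_update]; exact hc _ _ _)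
        rw [h1]
        simpa using this)
    -- Hoeffding's lemma for the dependence on the first variable
    have hinner : ∀ y t, ∫ z, Real.exp (t * (g (Fin.cons z y) - g₁ y)) ∂D
        ≤ Real.exp (((c / 2) ^ 2 : NNReal) * t ^ 2 / 2) := by
      intro y t
      have hosc : ∀ z z', g (Fin.cons z y) ≤ g (Fin.cons z' y) + c := fun z z' => by
        have := hc (Fin.cons z' y) 0 z
        rw [Fin.update_cons_zero] at this
        linarith [(abs_le.1 this).2]
      set a : ℝ := ⨅ z, g (Fin.cons z y) with ha
      have hbdd : BddBelow (Set.range fun z => g (Fin.cons z y)) :=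
        ⟨-M, by rintro _ ⟨z, rfl⟩; exact (abs_le.1 (hM _)).1⟩
      have hH := hasSubgaussianMGF_of_mem_Icc (μ := D) (X := fun z => g (Fin.cons z y))
        (a := a) (b := a + c) (hgz y).aemeasurable (ae_of_all _ fun z =>
          ⟨ciInf_le hbdd z, by
            have : g (Fin.cons z y) - c ≤ a := le_ciInf fun z' => by linarith [hosc z z']
            linarith⟩)
      have := hH.mgf_le t
      simpa [mgf] using this
    have hexpm : ∀ t, Measurable fun x => Real.exp (t * (g x - I)) := fun t =>
      Real.measurable_exp.comp ((hg.sub_const _).const_mul t)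
    have hexpb : ∀ t, ∃ A, ∀ x, |Real.exp (t * (g x - I))| ≤ A := fun t =>
      ⟨Real.exp (|t| * (M + |I|)), fun x => by
        rw [Real.abs_exp]
        refine Real.exp_le_exp.2 ((le_abs_self _).trans ?_)
        rw [abs_mul]
        gcongr
        exact (abs_sub _ _).trans (by gcongr; exact hM x)⟩
    refine ⟨fun t => ?_, fun t => ?_⟩
    · obtain ⟨A, hA⟩ := hexpb t
      exact Integrable.of_bound (hexpm t).aestronglyMeasurable A (ae_of_all _ hA)
    · rw [mgf, hchange _ (hexpm t) (hexpb t)]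
      have hsplit : ∀ y, ∫ z, Real.exp (t * (g (Fin.cons z y) - I)) ∂D
          = Real.exp (t * (g₁ y - I)) * ∫ z, Real.exp (t * (g (Fin.cons z y) - g₁ y)) ∂D := by
        intro y
        rw [← integral_const_mul]
        congr 1; ext z
        rw [← Real.exp_add]; ring_nf
      simp only [hsplit]
      calc ∫ y, Real.exp (t * (g₁ y - I)) * ∫ z, Real.exp (t * (g (Fin.cons z y) - g₁ y)) ∂D ∂P
          ≤ ∫ y, Real.exp (t * (g₁ y - I)) * Real.exp (((c / 2) ^ 2 : NNReal) * t ^ 2 / 2) ∂P := by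
            refine integral_mono_of_nonneg (ae_of_all _ fun y => by positivity) ?_
              (ae_of_all _ fun y => mul_le_mul_of_nonneg_left (hinner y t) (Real.exp_nonneg _))
            rw [hI₁]
            exact (ih.integrable_exp_mul t).mul_const _
        _ = mgf (fun y => g₁ y - ∫ y', g₁ y' ∂P) P t
              * Real.exp (((c / 2) ^ 2 : NNReal) * t ^ 2 / 2) := by
            rw [integral_mul_const, hI₁, mgf]
        _ ≤ Real.exp ((n * (c / 2) ^ 2 : NNReal) * t ^ 2 / 2)
              * Real.exp (((c / 2) ^ 2 : NNReal) * t ^ 2 / 2) := by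
            gcongr; exact ih.mgf_le t
        _ = Real.exp (((n + 1 : ℕ) * (c / 2) ^ 2 : NNReal) * t ^ 2 / 2) := by
            rw [← Real.exp_add]; push_cast; ring_nf

end McDiarmid

/-! ### Uniform deviation of quadratic forms -/

section Deviation
variable {E ι : Type*} [Fintype ι]

/-- The Euclidean unit ball of `ι → ℝ`. -/
def unitBall (ι : Type*) [Fintype ι] : Set (ι → ℝ) := {u | ∑ j, u j ^ 2 ≤ 1}

theorem isCompact_unitBall : IsCompact (unitBall ι) := by
  refine (isCompact_univ_pi fun _ : ι => isCompact_Icc (a := (-1 : ℝ)) (b := 1)).of_isClosed_subset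
    (isClosed_le (by fun_prop) continuous_const) fun u hu j _ => ?_
  refine abs_le.1 ((sq_le_one_iff_abs_le_one _).1 (le_trans ?_ hu))
  exact Finset.single_le_sum (f := fun j => u j ^ 2) (fun j _ => sq_nonneg _) (Finset.mem_univ j)

theorem zero_mem_unitBall : (0 : ι → ℝ) ∈ unitBall ι := by simp [unitBall]

/-- The quadratic form `u ↦ ⟨u, v⟩²`. -/
def sqForm (v u : ι → ℝ) : ℝ := (∑ j, u j * v j) ^ 2

theorem sqForm_nonneg (v u : ι → ℝ) : 0 ≤ sqForm v u := sq_nonneg _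

theorem sqForm_le (v u : ι → ℝ) : sqForm v u ≤ (∑ j, u j ^ 2) * ∑ j, v j ^ 2 :=
  Finset.sum_mul_sq_le_sq_mul_sq _ _ _

theorem sqForm_eq (v u : ι → ℝ) : sqForm v u = ∑ j, ∑ k, u j * u k * (v j * v k) := by
  rw [sqForm, sq, Finset.sum_mul_sum]
  exact Finset.sum_congr rfl fun j _ => Finset.sum_congr rfl fun k _ => by ring

theorem abs_mul_apply_le {ψ : E → ι → ℝ} {K : ℝ} (hK : ∀ z, ∑ j, ψ z j ^ 2 ≤ K) (z : E)
    (j k : ι) : |ψ z j * ψ z k| ≤ K := by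
  have h : ∀ j, ψ z j ^ 2 ≤ K := fun j => (Finset.single_le_sum (f := fun j => ψ z j ^ 2)
    (fun j _ => sq_nonneg _) (Finset.mem_univ j)).trans (hK z)
  rw [abs_le]
  constructor <;> nlinarith [h j, h k, sq_nonneg (ψ z j + ψ z k), sq_nonneg (ψ z j - ψ z k)]

theorem sqForm_mem_Icc {ψ : E → ι → ℝ} {K : ℝ} (hK : ∀ z, ∑ j, ψ z j ^ 2 ≤ K) {u : ι → ℝ}
    (hu : u ∈ unitBall ι) (z : E) : sqForm (ψ z) u ∈ Set.Icc 0 K := by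
  have h0 : 0 ≤ ∑ j, ψ z j ^ 2 := Finset.sum_nonneg fun j _ => sq_nonneg _
  refine ⟨sqForm_nonneg _ _, (sqForm_le _ _).trans (le_trans ?_ (hK z))⟩
  exact mul_le_of_le_one_left h0 hu

variable [MeasurableSpace E] (D : Measure E) (ψ : E → ι → ℝ) {n : ℕ} {K : ℝ}

/-- The matrix of second moments of `ψ` minus its empirical counterpart on the sample `x`. -/
noncomputable def momentGap (x : Fin n → E) (j k : ι) : ℝ :=
  (∫ z, ψ z j * ψ z k ∂D) - 1 / (n : ℝ) * ∑ i, ψ (x i) j * ψ (x i) k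

/-- The quadratic form of `momentGap`. -/
noncomputable def devForm (x : Fin n → E) (u : ι → ℝ) : ℝ :=
  ∑ j, ∑ k, u j * u k * momentGap D ψ x j k

/-- The largest excess, over the Euclidean unit ball, of the expectation of `⟨u, ψ⟩²` over its
empirical mean on the sample `x`. -/
noncomputable def supDev (x : Fin n → E) : ℝ := sSup (devForm D ψ x '' unitBall ι)

section Basic
variable {D ψ}

theorem continuous_devForm (x : Fin n → E) : Continuous (devForm D ψ x) := by
  unfold devForm; fun_prop

theorem bddAbove_devForm (x : Fin n → E) : BddAbove (devForm D ψ x '' unitBall ι) :=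
  (isCompact_unitBall.image (continuous_devForm x)).bddAbove

theorem devForm_le_supDev (x : Fin n → E) {u : ι → ℝ} (hu : u ∈ unitBall ι) :
    devForm D ψ x u ≤ supDev D ψ x :=
  le_csSup (bddAbove_devForm x) ⟨u, hu, rfl⟩

theorem supDev_le {x : Fin n → E} {a : ℝ} (h : ∀ u ∈ unitBall ι, devForm D ψ x u ≤ a) :
    supDev D ψ x ≤ a :=
  csSup_le ⟨_, 0, zero_mem_unitBall, rfl⟩ (by rintro _ ⟨u, hu, rfl⟩; exact h u hu)

theorem supDev_nonneg (x : Fin n → E) : 0 ≤ supDev D ψ x :=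
  le_trans (by simp [devForm]) (devForm_le_supDev x zero_mem_unitBall)

theorem devForm_le_mul_supDev (x : Fin n → E) (u : ι → ℝ) :
    devForm D ψ x u ≤ (∑ j, u j ^ 2) * supDev D ψ x := by
  set s : ℝ := ∑ j, u j ^ 2 with hs
  have hs0 : 0 ≤ s := Finset.sum_nonneg fun j _ => sq_nonneg _
  rcases hs0.eq_or_lt with h0 | h0
  · have hu : ∀ j, u j = 0 := fun j => by
      have := (Finset.sum_eq_zero_iff_of_nonneg fun j _ => sq_nonneg (u j)).1
        (hs.symm.trans h0.symm) j (Finset.mem_univ j)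
      exact pow_eq_zero_iff two_ne_zero |>.1 this
    simp [devForm, hu, ← h0]
  · have hsq : √s ^ 2 = s := Real.sq_sqrt hs0
    have hne : √s ≠ 0 := (Real.sqrt_pos.2 h0).ne'
    have hmem : (fun j => u j / √s) ∈ unitBall ι := by
      simp only [unitBall, Set.mem_ofPred_eq, div_pow, hsq, ← Finset.sum_div, ← hs]
      exact (div_self h0.ne').le
    have h1 : devForm D ψ x u = s * devForm D ψ x fun j => u j / √s := by
      simp only [devForm, Finset.mul_sum]
      refine Finset.sum_congr rfl fun j _ => Finset.sum_congr rfl fun k _ => ?_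
      field_simp
      rw [hsq]
    rw [h1]
    exact mul_le_mul_of_nonneg_left (devForm_le_supDev x hmem) hs0

end Basic

variable [TopologicalSpace E] {ψ}

theorem continuous_supDev (hψ : Continuous ψ) : Continuous (supDev D ψ : (Fin n → E) → ℝ) := by
  refine isCompact_unitBall.continuous_sSup (f := devForm D ψ) ?_
  have : Continuous fun p : (Fin n → E) × (ι → ℝ) => devForm D ψ p.1 p.2 := by
    unfold devForm momentGap
    fun_prop
  exact this

variable [BorelSpace E] [IsProbabilityMeasure D]

theorem integrable_mul_apply (hψ : Continuous ψ) (hK : ∀ z, ∑ j, ψ z j ^ 2 ≤ K)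
    (j k : ι) : Integrable (fun z => ψ z j * ψ z k) D :=
  Integrable.of_bound (by fun_prop : Continuous fun z => ψ z j * ψ z k).aestronglyMeasurable K
    (ae_of_all _ fun z => abs_mul_apply_le hK z j k)

theorem devForm_eq (hψ : Continuous ψ) (hK : ∀ z, ∑ j, ψ z j ^ 2 ≤ K)
    (x : Fin n → E) (u : ι → ℝ) :
    devForm D ψ x u = (∫ z, sqForm (ψ z) u ∂D) - 1 / (n : ℝ) * ∑ i, sqForm (ψ (x i)) u := by
  have h1 : ∫ z, sqForm (ψ z) u ∂D = ∑ j, ∑ k, u j * u k * ∫ z, ψ z j * ψ z k ∂D := by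
    simp only [sqForm_eq]
    rw [integral_finsetSum _ fun j _ => integrable_finsetSum _ fun k _ =>
      (integrable_mul_apply D hψ hK j k).const_mul _]
    refine Finset.sum_congr rfl fun j _ => ?_
    rw [integral_finsetSum _ fun k _ => (integrable_mul_apply D hψ hK j k).const_mul _]
    exact Finset.sum_congr rfl fun k _ => integral_const_mul _ _
  have h2 : ∑ i, sqForm (ψ (x i)) u
      = ∑ j, ∑ k, u j * u k * ∑ i, ψ (x i) j * ψ (x i) k := by
    simp only [sqForm_eq, Finset.mul_sum]
    rw [Finset.sum_comm]
    exact Finset.sum_congr rfl fun j _ => Finset.sum_comm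
  rw [h1, h2, Finset.mul_sum, ← Finset.sum_sub_distrib, devForm]
  refine Finset.sum_congr rfl fun j _ => ?_
  rw [Finset.mul_sum, ← Finset.sum_sub_distrib]
  exact Finset.sum_congr rfl fun k _ => by rw [momentGap]; ring

theorem abs_supDev_le (hψ : Continuous ψ) (hK : ∀ z, ∑ j, ψ z j ^ 2 ≤ K)
    (x : Fin n → E) : |supDev D ψ x| ≤ K := by
  rw [abs_of_nonneg (supDev_nonneg x)]
  refine supDev_le fun u hu => ?_
  rw [devForm_eq D hψ hK]
  have h1 : ∫ z, sqForm (ψ z) u ∂D ≤ K := by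
    have := norm_integral_le_of_norm_le_const (μ := D) (f := fun z => sqForm (ψ z) u) (C := K)
      (ae_of_all _ fun z => by
        have := sqForm_mem_Icc hK hu z
        rw [Real.norm_eq_abs, abs_of_nonneg this.1]; exact this.2)
    simpa using (le_abs_self _).trans this
  have h2 : 0 ≤ 1 / (n : ℝ) * ∑ i, sqForm (ψ (x i)) u :=
    mul_nonneg (by positivity) (Finset.sum_nonneg fun i _ => sqForm_nonneg _ _)
  linarith

/-- The bounded difference property that McDiarmid's inequality requires. -/
theorem abs_supDev_update_sub_le (hψ : Continuous ψ) (hK : ∀ z, ∑ j, ψ z j ^ 2 ≤ K)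
    (x : Fin n → E) (i : Fin n) (z : E) :
    |supDev D ψ (Function.update x i z) - supDev D ψ x| ≤ K / n := by
  have key : ∀ (x : Fin n → E) (z : E),
      supDev D ψ (Function.update x i z) ≤ supDev D ψ x + K / n := by
    intro x z
    refine supDev_le fun u hu => ?_
    have h1 := devForm_le_supDev (D := D) (ψ := ψ) x hu
    rw [devForm_eq D hψ hK] at h1 ⊢
    -- only the summand of index `i` changes
    have h2 : ∑ l, sqForm (ψ (x l)) u ≤ (∑ l, sqForm (ψ (Function.update x i z l)) u) + K := by
      rw [← Finset.add_sum_erase _ _ (Finset.mem_univ i),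
        ← Finset.add_sum_erase (a := i) _ (fun l => sqForm (ψ (Function.update x i z l)) u)
          (Finset.mem_univ i)]
      have h3 : ∑ l ∈ Finset.univ.erase i, sqForm (ψ (Function.update x i z l)) u
          = ∑ l ∈ Finset.univ.erase i, sqForm (ψ (x l)) u :=
        Finset.sum_congr rfl fun l hl => by
          rw [Function.update_of_ne (Finset.ne_of_mem_erase hl)]
      rw [h3, Function.update_self]
      linarith [(sqForm_mem_Icc hK hu (x i)).2, (sqForm_mem_Icc hK hu z).1]
    have h4 := mul_le_mul_of_nonneg_left h2 (show 0 ≤ 1 / (n : ℝ) by positivity)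
    rw [mul_add, one_div_mul_eq_div _ K] at h4
    linarith
  rw [abs_le]
  constructor
  · have := key (Function.update x i z) (x i)
    rw [Function.update_idem, Function.update_eq_self] at this
    linarith
  · linarith [key x z]

/-- The expectation of the uniform deviation. The quadratic form is bounded by the Frobenius norm
of its matrix, whose entries are centred averages of `n` independent terms. -/
theorem integral_supDev_le [SecondCountableTopology E] (hψ : Continuous ψ)
    (hK : ∀ z, ∑ j, ψ z j ^ 2 ≤ K)
    (hn : 0 < n) (hK0 : 0 ≤ K) :
    ∫ x : Fin n → E, supDev D ψ x ∂(Measure.pi fun _ => D) ≤ K / √n := by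
  set P : Measure (Fin n → E) := Measure.pi fun _ => D with hP
  have hn0 : (0 : ℝ) < n := by exact_mod_cast hn
  set Fr : (Fin n → E) → ℝ := fun x => ∑ j, ∑ k, momentGap D ψ x j k ^ 2 with hFr
  have hgapc : ∀ j k, Continuous fun x : Fin n → E => momentGap D ψ x j k := fun j k => by
    unfold momentGap; fun_prop
  have hgapb : ∀ (x : Fin n → E) j k, |momentGap D ψ x j k| ≤ 2 * K := fun x j k => by
    have h1 := norm_integral_le_of_norm_le_const (μ := D) (f := fun z => ψ z j * ψ z k) (C := K)
      (ae_of_all _ fun z => abs_mul_apply_le hK z j k)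
    have h2 : |1 / (n : ℝ) * ∑ i, ψ (x i) j * ψ (x i) k| ≤ K := by
      rw [abs_mul, abs_of_nonneg (by positivity : 0 ≤ 1 / (n : ℝ)), one_div_mul_eq_div,
        div_le_iff₀ hn0]
      refine (Finset.abs_sum_le_sum_abs _ _).trans ?_
      refine (Finset.sum_le_sum fun i _ => abs_mul_apply_le hK (x i) j k).trans ?_
      simp [mul_comm]
    refine (abs_sub _ _).trans ?_
    simp only [Real.norm_eq_abs, probReal_univ, mul_one] at h1
    linarith
  have hsup : ∀ x, supDev D ψ x ^ 2 ≤ Fr x := by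
    intro x
    have hFr0 : 0 ≤ Fr x := Finset.sum_nonneg fun j _ => Finset.sum_nonneg fun k _ => sq_nonneg _
    have : supDev D ψ x ≤ √(Fr x) := by
      refine supDev_le fun u hu => Real.le_sqrt_of_sq_le ?_
      have h1 : devForm D ψ x u
          = ∑ p : ι × ι, u p.1 * u p.2 * momentGap D ψ x p.1 p.2 := by
        rw [Fintype.sum_prod_type]; rfl
      have h2 : ∑ p : ι × ι, (u p.1 * u p.2) ^ 2 = (∑ j, u j ^ 2) ^ 2 := by
        rw [Fintype.sum_prod_type, sq, Finset.sum_mul_sum]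
        simp only [mul_pow]
      have h3 : ∑ p : ι × ι, momentGap D ψ x p.1 p.2 ^ 2 = Fr x := by
        rw [Fintype.sum_prod_type]
      rw [h1]
      refine (Finset.sum_mul_sq_le_sq_mul_sq _ _ _).trans ?_
      rw [h2, h3]
      have h4 : (∑ j, u j ^ 2) ^ 2 ≤ 1 := by
        have h5 : 0 ≤ ∑ j, u j ^ 2 := Finset.sum_nonneg fun j _ => sq_nonneg _
        exact pow_le_one₀ h5 hu
      exact mul_le_of_le_one_left hFr0 h4
    calc supDev D ψ x ^ 2 ≤ √(Fr x) ^ 2 := by gcongr; exact supDev_nonneg x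
      _ = Fr x := Real.sq_sqrt hFr0
  have hentry : ∀ j k, ∫ x, momentGap D ψ x j k ^ 2 ∂P
      ≤ 1 / n * ∫ z, ψ z j ^ 2 * ψ z k ^ 2 ∂D := by
    intro j k
    have hmem : MemLp (fun z => ψ z j * ψ z k) 2 D :=
      MemLp.of_bound (by fun_prop : Continuous fun z => ψ z j * ψ z k).aestronglyMeasurable K
        (ae_of_all _ fun z => abs_mul_apply_le hK z j k)
    have hvar := variance_sum_pi (μ := fun _ : Fin n => D)
      (X := fun _ z => ψ z j * ψ z k) (fun _ => hmem)
    have hsumc : Continuous fun x : Fin n → E => ∑ i, ψ (x i) j * ψ (x i) k := by fun_prop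
    have hmean : ∫ x, (∑ i, fun x : Fin n → E => ψ (x i) j * ψ (x i) k) x ∂P
        = n * ∫ z, ψ z j * ψ z k ∂D := by
      simp only [Finset.sum_apply]
      rw [integral_finsetSum _ fun i _ => ?_]
      · have : ∀ i : Fin n, ∫ x : Fin n → E, ψ (x i) j * ψ (x i) k ∂P = ∫ z, ψ z j * ψ z k ∂D :=
          fun i => integral_comp_eval (μ := fun _ : Fin n => D) (i := i)
            (f := fun z => ψ z j * ψ z k) hmem.1
        simp [this]
      · exact Integrable.of_bound (by fun_prop : Continuous fun x : Fin n → E =>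
          ψ (x i) j * ψ (x i) k).aestronglyMeasurable K
          (ae_of_all _ fun x => abs_mul_apply_le hK (x i) j k)
    rw [variance_eq_integral (by
      have : (∑ i, fun x : Fin n → E => ψ (x i) j * ψ (x i) k)
        = fun x => ∑ i, ψ (x i) j * ψ (x i) k := by ext; simp
      rw [this]; exact hsumc.aemeasurable)] at hvar
    rw [hmean] at hvar
    have h1 : ∫ x, momentGap D ψ x j k ^ 2 ∂P = 1 / (n : ℝ) ^ 2 *
        ∫ x, ((∑ i, fun x : Fin n → E => ψ (x i) j * ψ (x i) k) x
          - n * ∫ z, ψ z j * ψ z k ∂D) ^ 2 ∂P := by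
      rw [← integral_const_mul]
      congr 1; ext x
      simp only [Finset.sum_apply, momentGap]
      field_simp
      ring
    rw [h1, hvar, Finset.sum_const, Finset.card_univ, Fintype.card_fin, nsmul_eq_mul, ← mul_assoc]
    have h2 : 1 / (n : ℝ) ^ 2 * n = 1 / n := by field_simp
    rw [h2]
    refine mul_le_mul_of_nonneg_left ?_ (by positivity)
    refine (variance_le_expectation_sq hmem.1).trans (le_of_eq ?_)
    congr 1; ext z
    simp [mul_pow]
  have hFrint : ∫ x, Fr x ∂P ≤ K ^ 2 / n := by
    have hint : ∀ j k, Integrable (fun x : Fin n → E => momentGap D ψ x j k ^ 2) P := fun j k =>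
      Integrable.of_bound ((hgapc j k).pow 2).aestronglyMeasurable ((2 * K) ^ 2)
        (ae_of_all _ fun x => by
          rw [Real.norm_eq_abs, abs_pow]
          exact pow_le_pow_left₀ (abs_nonneg _) (hgapb x j k) 2)
    have hint' : ∀ j k, Integrable (fun z => ψ z j ^ 2 * ψ z k ^ 2) D := fun j k =>
      Integrable.of_bound (by fun_prop : Continuous fun z =>
        ψ z j ^ 2 * ψ z k ^ 2).aestronglyMeasurable (K ^ 2)
        (ae_of_all _ fun z => by
          rw [Real.norm_eq_abs, ← mul_pow, abs_pow]
          exact pow_le_pow_left₀ (abs_nonneg _) (abs_mul_apply_le hK z j k) 2)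
    calc ∫ x, Fr x ∂P = ∑ j, ∑ k, ∫ x, momentGap D ψ x j k ^ 2 ∂P := by
          rw [hFr, integral_finsetSum _ fun j _ => integrable_finsetSum _ fun k _ => hint j k]
          exact Finset.sum_congr rfl fun j _ => integral_finsetSum _ fun k _ => hint j k
      _ ≤ ∑ j, ∑ k, 1 / (n : ℝ) * ∫ z, ψ z j ^ 2 * ψ z k ^ 2 ∂D :=
          Finset.sum_le_sum fun j _ => Finset.sum_le_sum fun k _ => hentry j k
      _ = 1 / (n : ℝ) * ∫ z, (∑ j, ψ z j ^ 2) ^ 2 ∂D := by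
          simp only [← Finset.mul_sum]
          congr 1
          simp only [sq (∑ j, ψ _ j ^ 2), Finset.sum_mul_sum]
          rw [integral_finsetSum _ fun j _ => integrable_finsetSum _ fun k _ => hint' j k]
          exact Finset.sum_congr rfl fun j _ => (integral_finsetSum _ fun k _ => hint' j k).symm
      _ ≤ 1 / (n : ℝ) * K ^ 2 := by
          refine mul_le_mul_of_nonneg_left ?_ (by positivity)
          have := norm_integral_le_of_norm_le_const (μ := D) (C := K ^ 2)
            (f := fun z => (∑ j, ψ z j ^ 2) ^ 2) (ae_of_all _ fun z => by
              rw [Real.norm_eq_abs, abs_of_nonneg (sq_nonneg _)]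
              exact pow_le_pow_left₀ (Finset.sum_nonneg fun j _ => sq_nonneg _) (hK z) 2)
          simpa using (le_abs_self _).trans this
      _ = K ^ 2 / n := by ring
  have hsupL : MemLp (supDev D ψ : (Fin n → E) → ℝ) 2 P :=
    MemLp.of_bound (continuous_supDev D hψ).aestronglyMeasurable K
      (ae_of_all _ fun x => abs_supDev_le D hψ hK x)
  have hFrI : Integrable Fr P := by
    refine integrable_finsetSum _ fun j _ => integrable_finsetSum _ fun k _ => ?_
    exact Integrable.of_bound ((hgapc j k).pow 2).aestronglyMeasurable ((2 * K) ^ 2)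
        (ae_of_all _ fun x => by
          rw [Real.norm_eq_abs, abs_pow]
          exact pow_le_pow_left₀ (abs_nonneg _) (hgapb x j k) 2)
  -- `(E g) ^ 2 ≤ E g ^ 2`, as the variance is nonnegative
  have hsq : (∫ x, supDev D ψ x ∂P) ^ 2 ≤ K ^ 2 / n := by
    have h1 := variance_nonneg (supDev D ψ : (Fin n → E) → ℝ) P
    rw [variance_eq_sub hsupL] at h1
    have h2 : ∫ x, ((supDev D ψ : (Fin n → E) → ℝ) ^ 2) x ∂P ≤ ∫ x, Fr x ∂P :=
      integral_mono hsupL.integrable_sq hFrI hsup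
    linarith
  refine (abs_le_of_sq_le_sq' ?_ (by positivity)).2
  rwa [div_pow, Real.sq_sqrt hn0.le]

/-- With probability at least `1 - δ`, the expectation of `⟨u, ψ⟩²` exceeds its empirical
mean by at most `‖u‖² K (1 + √(log (1/δ) / 2)) / √n`, simultaneously for all `u`. -/
theorem measure_supDev_gt_le [SecondCountableTopology E] (hψ : Continuous ψ)
    (hK : ∀ z, ∑ j, ψ z j ^ 2 ≤ K)
    (hn : 0 < n) (hK0 : 0 < K) {δ : ℝ} (hδ : 0 < δ) (hδ1 : δ ≤ 1) :
    (Measure.pi fun _ : Fin n => D) {x | K * (1 + √(Real.log (1 / δ) / 2)) / √n < supDev D ψ x}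
      ≤ ENNReal.ofReal δ := by
  set P : Measure (Fin n → E) := Measure.pi fun _ => D with hP
  have hn0 : (0 : ℝ) < n := by exact_mod_cast hn
  set l : ℝ := Real.log (1 / δ) with hl
  have hl0 : 0 ≤ l := Real.log_nonneg (by rw [le_div_iff₀ hδ]; linarith)
  have hs0 : 0 < √(n : ℝ) := Real.sqrt_pos.2 hn0
  have hsg := hasSubgaussianMGF_of_bounded_differences D ⟨K / n, by positivity⟩ (M := K) n
    (supDev D ψ) (continuous_supDev D hψ).measurable (abs_supDev_le D hψ hK)
    (abs_supDev_update_sub_le D hψ hK)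
  have htail := hsg.measure_ge_le (ε := K * √(l / 2) / √n) (by positivity)
  have hexp : Real.exp (-(K * √(l / 2) / √n) ^ 2 /
      (2 * ((n * (⟨K / n, by positivity⟩ / 2) ^ 2 : NNReal) : ℝ))) = δ := by
    have h1 : ((n * (⟨K / n, by positivity⟩ / 2) ^ 2 : NNReal) : ℝ) = n * (K / n / 2) ^ 2 := by
      push_cast; rfl
    have h2 : (K * √(l / 2) / √n) ^ 2 = K ^ 2 * (l / 2) / n := by
      rw [div_pow, mul_pow, Real.sq_sqrt (by positivity), Real.sq_sqrt hn0.le]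
    rw [h1, h2]
    have h3 : -(K ^ 2 * (l / 2) / n) / (2 * (n * (K / n / 2) ^ 2)) = -l := by
      field_simp
    rw [h3, hl, one_div, Real.log_inv, neg_neg, Real.exp_log hδ]
  rw [hexp] at htail
  refine (measure_mono fun x hx => ?_).trans
    ((ENNReal.le_ofReal_iff_toReal_le (measure_ne_top P _) hδ.le).2 htail)
  have hx : K * (1 + √(l / 2)) / √n < supDev D ψ x := hx
  have h1 := integral_supDev_le D hψ hK hn hK0.le
  have h2 : K * (1 + √(l / 2)) / √n = K / √n + K * √(l / 2) / √n := by ring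
  simp only [Set.mem_ofPred_eq]
  linarith

end Deviation

/-! ### Numerical estimates -/

section Numerics

/-- The sample size turns the deviation factor into `5.75 a ^ (2 Λ)`. The constant is governed by
the worst case `δ = 1 / 2`. -/
theorem one_add_sqrt_div_sqrt_le {a δ : ℝ} {Λ n : ℕ} (ha : 0 < a) (hδ : 0 < δ) (hδ2 : δ ≤ 1 / 2)
    (hn : (1 / a) ^ (4 * Λ) * (Real.log (1 / δ) / 9) ≤ n) :
    0 < n ∧ (1 + √(Real.log (1 / δ) / 2)) / √n ≤ 5.75 * a ^ (2 * Λ) := by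
  set l : ℝ := Real.log (1 / δ) with hl
  have hl2 : Real.log 2 ≤ l := by
    refine Real.log_le_log (by norm_num) ?_
    rw [le_div_iff₀ hδ]; linarith
  have hl1 : 0.6931 ≤ l := by linarith [Real.log_two_gt_d9]
  set A : ℝ := a ^ (2 * Λ) with hA
  have hA0 : 0 < A := by positivity
  have hAA : (1 / a) ^ (4 * Λ) = 1 / A ^ 2 := by
    rw [one_div_pow, hA, ← pow_mul]; ring_nf
  rw [hAA] at hn
  have hn0 : (0 : ℝ) < n := lt_of_lt_of_le (by positivity) hn
  refine ⟨by exact_mod_cast hn0, ?_⟩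
  have hs : 0.83 ≤ √l := Real.le_sqrt_of_sq_le (by norm_num; linarith)
  have hsn : √l / (3 * A) ≤ √n := by
    refine Real.le_sqrt_of_sq_le (le_trans (le_of_eq ?_) hn)
    rw [div_pow, Real.sq_sqrt (by linarith)]; field_simp; norm_num
  have hhalf : √(l / 2) ≤ 0.7072 * √l := by
    refine Real.sqrt_le_iff.2 ⟨by positivity, ?_⟩
    rw [mul_pow, Real.sq_sqrt (by linarith)]; norm_num; linarith
  rw [div_le_iff₀ (Real.sqrt_pos.2 hn0)]
  calc 1 + √(l / 2) ≤ 5.75 / 3 * √l := by linarith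
    _ = 5.75 * A * (√l / (3 * A)) := by field_simp
    _ ≤ 5.75 * A * √n := by gcongr

/-- The place where `q < 1 / e` is used: the gain `e ^ (2 q ^ 2 - 1)` per unit of `Λ` is below
`0.49`. -/
theorem exp_two_mul_sq_le {q : ℝ} (hq0 : 0 < q) (hq : q < 1 / Real.exp 1) :
    Real.exp (1 + 2 * q ^ 2) ≤ 0.49 * Real.exp 2 := by
  have he := Real.exp_one_gt_d9
  have hq1 : q ≤ 0.36788 := by
    refine hq.le.trans ?_
    rw [div_le_iff₀ (by positivity)]; linarith
  have hqq : q ^ 2 ≤ 0.13534 := by nlinarith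
  have hexp : 1 / 0.49 ≤ Real.exp 0.7293 := by
    have := Real.sum_le_exp_of_nonneg (show (0 : ℝ) ≤ 0.7293 by norm_num) 4
    refine le_trans ?_ this
    simp only [Finset.sum_range_succ, Finset.sum_range_zero, Nat.factorial]
    norm_num
  have h : Real.exp (1 + 2 * q ^ 2) * Real.exp 0.7293 ≤ Real.exp 2 := by
    rw [← Real.exp_add]; exact Real.exp_le_exp.2 (by linarith)
  have h0 := Real.exp_pos (1 + 2 * q ^ 2)
  have h1 : Real.exp (1 + 2 * q ^ 2) * (1 / 0.49) ≤ Real.exp 2 :=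
    (mul_le_mul_of_nonneg_left hexp h0.le).trans h
  linarith

/-- The product of the bounds on the norms of the features and of the coefficients (per unit of
`B`) is at most `0.7 (d e / Λ) ^ Λ`. -/
theorem sqrt_mul_sqrt_le {t q : ℝ} {Λ : ℕ} (hΛ : 1 ≤ Λ) (ht : 0 ≤ t) (hq0 : 0 < q)
    (hq : q < 1 / Real.exp 1) :
    √((t * Real.exp (2 * q ^ 2)) ^ Λ) * √((t * Real.exp 1) ^ Λ)
      ≤ 0.7 * (t * Real.exp 1) ^ Λ := by
  rw [← Real.sqrt_mul (by positivity)]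
  refine Real.sqrt_le_iff.2 ⟨by positivity, ?_⟩
  have h1 : Real.exp (1 + 2 * q ^ 2) ^ Λ ≤ 0.49 * Real.exp 2 ^ Λ := by
    calc Real.exp (1 + 2 * q ^ 2) ^ Λ ≤ (0.49 * Real.exp 2) ^ Λ := by
          gcongr; exact exp_two_mul_sq_le hq0 hq
      _ = 0.49 ^ Λ * Real.exp 2 ^ Λ := mul_pow _ _ _
      _ ≤ 0.49 * Real.exp 2 ^ Λ := by
          gcongr
          exact pow_le_of_le_one (by norm_num) (by norm_num) (by omega)
  have h2 : (t * Real.exp (2 * q ^ 2)) ^ Λ * (t * Real.exp 1) ^ Λ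
      = (t ^ Λ) ^ 2 * Real.exp (1 + 2 * q ^ 2) ^ Λ := by
    rw [Real.exp_add]; simp only [mul_pow]; ring
  have h3 : (0.7 * (t * Real.exp 1) ^ Λ) ^ 2 = (t ^ Λ) ^ 2 * (0.49 * Real.exp 2 ^ Λ) := by
    rw [show (2 : ℝ) = 1 + 1 by norm_num, Real.exp_add]; simp only [mul_pow]; ring
  rw [h2, h3]
  gcongr

theorem one_le_mul_pow {t : ℝ} {Λ : ℕ} (hΛ : 1 ≤ Λ) (ht : 1 ≤ t) :
    1 ≤ 0.368 * (t * Real.exp 1) ^ Λ := by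
  have he := Real.exp_one_gt_d9
  have h1 : Real.exp 1 ≤ t * Real.exp 1 := le_mul_of_one_le_left (Real.exp_nonneg 1) ht
  have h2 : t * Real.exp 1 ≤ (t * Real.exp 1) ^ Λ :=
    le_self_pow₀ (by linarith) (by omega)
  linarith

end Numerics

/-! ### From the training error to the prediction error -/

section Generalization
variable {L m Λ n : ℕ}

/-- The truncated features, scaled by `s`, together with the target function as an additional
coordinate. -/
noncomputable def augFeature (s : ℝ) (f : (Fin m → ℝ) → ℝ) (x : Fin m → ℝ) :
    Option (Freq (L * m) Λ) → ℝ
  | none => f x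
  | some ω => s * feature ω.1 x

/-- The coordinates with `⟨augWeight s w, augFeature s f x⟩ = h_w(x) - f(x)`. -/
noncomputable def augWeight (s : ℝ) (w : EuclideanSpace ℝ (Freq (L * m) Λ)) :
    Option (Freq (L * m) Λ) → ℝ
  | none => -1
  | some ω => w ω / s

theorem continuous_augFeature (s : ℝ) {f : (Fin m → ℝ) → ℝ} (hf : Continuous f) :
    Continuous (augFeature s f : (Fin m → ℝ) → Option (Freq (L * m) Λ) → ℝ) := by
  refine continuous_pi fun j => ?_
  cases j with
  | none => exact hf
  | some ω => exact continuous_const.mul (continuous_feature ω.1)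

theorem sqForm_augFeature {s : ℝ} (hs : s ≠ 0) (f : (Fin m → ℝ) → ℝ) (x : Fin m → ℝ)
    (w : EuclideanSpace ℝ (Freq (L * m) Λ)) :
    sqForm (augFeature s f x) (augWeight s w) = (hyp w x - f x) ^ 2 := by
  have : ∀ ω : Freq (L * m) Λ, w ω / s * (s * feature ω.1 x) = feature ω.1 x * w ω := fun ω => by
    field_simp
  simp only [sqForm, Fintype.sum_option, augFeature, augWeight, this]
  rw [hyp]; ring

theorem sum_augWeight_sq (s : ℝ) (w : EuclideanSpace ℝ (Freq (L * m) Λ)) :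
    ∑ j, augWeight s w j ^ 2 = 1 + ‖w‖ ^ 2 / s ^ 2 := by
  simp only [Fintype.sum_option, augWeight, div_pow, ← Finset.sum_div, EuclideanSpace.norm_sq_eq,
    Real.norm_eq_abs, sq_abs]
  norm_num

theorem sum_augFeature_sq (s : ℝ) (f : (Fin m → ℝ) → ℝ) (x : Fin m → ℝ) :
    ∑ j : Option (Freq (L * m) Λ), augFeature s f x j ^ 2
      = f x ^ 2 + s ^ 2 * ∑ ω : Freq (L * m) Λ, feature ω.1 x ^ 2 := by
  simp only [Fintype.sum_option, augFeature, mul_pow, Finset.mul_sum]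

theorem trainError_nonneg (x : Fin n → Fin m → ℝ) (y : Fin n → ℝ)
    (w : EuclideanSpace ℝ (Freq (L * m) Λ)) : 0 ≤ trainError x y w :=
  mul_nonneg (by positivity) (Finset.sum_nonneg fun _ _ => sq_nonneg _)

theorem mean_le_of_forall_le {a : Fin n → ℝ} {b : ℝ} (hn : 0 < n) (h : ∀ i, a i ≤ b) :
    1 / (n : ℝ) * ∑ i, a i ≤ b := by
  have hn0 : (0 : ℝ) < n := by exact_mod_cast hn
  rw [one_div_mul_eq_div, div_le_iff₀ hn0]
  refine (Finset.sum_le_sum fun i _ => h i).trans ?_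
  simp [mul_comm]

variable {q R B : ℝ}

/-- The bound on the norm of the truncated coefficient vector. -/
noncomputable def coeffBound (d Λ : ℕ) (q B : ℝ) : ℝ :=
  B * √((d * Real.exp (2 * q ^ 2) / Λ) ^ Λ)

/-- The scale of the features in `augFeature`, chosen to balance the two summands of
`‖augFeature‖ ^ 2`. -/
noncomputable def featureScale (d Λ : ℕ) (q B : ℝ) : ℝ :=
  √(B * coeffBound d Λ q B / √((d * Real.exp 1 / Λ) ^ Λ))

/-- The bound on `‖augFeature‖ ^ 2`. -/
noncomputable def augBound (d Λ : ℕ) (q B : ℝ) : ℝ :=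
  B ^ 2 * (1 + √((d * Real.exp (2 * q ^ 2) / Λ) ^ Λ) * √((d * Real.exp 1 / Λ) ^ Λ))

theorem coeffBound_pos {d : ℕ} (hΛ : 0 < Λ) (hd : 0 < d) (hB : 0 < B) :
    0 < coeffBound d Λ q B := by
  unfold coeffBound; positivity

theorem featureScale_sq {d : ℕ} (hB : 0 < B) :
    featureScale d Λ q B ^ 2 = B * coeffBound d Λ q B / √((d * Real.exp 1 / Λ) ^ Λ) :=
  Real.sq_sqrt (by unfold coeffBound; positivity)

theorem featureScale_pos {d : ℕ} (hΛ : 0 < Λ) (hd : 0 < d) (hB : 0 < B) :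
    0 < featureScale d Λ q B := by
  have := coeffBound_pos (q := q) hΛ hd hB
  unfold featureScale; positivity

theorem sum_augFeature_sq_le (hΛ : 1 ≤ Λ) (hΛd : Λ ≤ L * m) (hB : 0 < B)
    {f : (Fin m → ℝ) → ℝ} (hf : ∀ x, |f x| ≤ B) (x : Fin m → ℝ) :
    ∑ j : Option (Freq (L * m) Λ), augFeature (featureScale (L * m) Λ q B) f x j ^ 2
      ≤ augBound (L * m) Λ q B := by
  have hd : 0 < L * m := by omega
  rw [sum_augFeature_sq, featureScale_sq hB, augBound]
  have h1 : f x ^ 2 ≤ B ^ 2 := sq_le_sq' (abs_le.1 (hf x)).1 (abs_le.1 (hf x)).2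
  have h2 := sum_feature_sq_le hΛ hΛd x
  set F : ℝ := (((L * m : ℕ) : ℝ) * Real.exp 1 / Λ) ^ Λ with hF
  have hF0 : 0 < F := by positivity
  have hW := coeffBound_pos (q := q) hΛ hd hB
  have h3 : B * coeffBound (L * m) Λ q B / √F * F = B ^ 2 *
      (√((((L * m : ℕ) : ℝ) * Real.exp (2 * q ^ 2) / Λ) ^ Λ) * √F) := by
    nth_rewrite 2 [← Real.mul_self_sqrt hF0.le]
    have : √F ≠ 0 := (Real.sqrt_pos.2 hF0).ne'
    rw [coeffBound]; field_simp
  have h4 := mul_le_mul_of_nonneg_left h2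
    (show 0 ≤ B * coeffBound (L * m) Λ q B / √F by positivity)
  rw [h3] at h4
  linarith

/-- If the uniform deviation is below its high-probability threshold, a hypothesis with small
training error and with norm at most `ρ` times `coeffBound` has small prediction error. -/
theorem predError_le_of_supDev_le (D : Measure (Fin m → ℝ)) [IsProbabilityMeasure D]
    {f : (Fin m → ℝ) → ℝ} (hfc : Continuous f) (hf : ∀ x, |f x| ≤ B) (hB : 0 < B)
    (hΛ : 1 ≤ Λ) (hΛd : Λ ≤ L * m) (hq0 : 0 < q) (hR : 0 ≤ R) (hqR : q * (1 + R) < 1 / Real.exp 1)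
    {δ : ℝ} (hδ : 0 < δ) (hδ2 : δ ≤ 1 / 2)
    (hn : (1 / (q * (1 + R))) ^ (4 * Λ) * (Real.log (1 / δ) / 9) ≤ n)
    {x : Fin n → Fin m → ℝ} {y : Fin n → ℝ}
    (hy : ∀ i, |y i - f (x i)| ≤ √(targetError (L * m) Λ q R B) / 4)
    (hdev : supDev D (augFeature (L := L) (Λ := Λ) (featureScale (L * m) Λ q B) f) x
      ≤ augBound (L * m) Λ q B * (1 + √(Real.log (1 / δ) / 2)) / √n)
    {w : EuclideanSpace ℝ (Freq (L * m) Λ)} {A ρ : ℝ}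
    (hA : trainError x y w ≤ A * targetError (L * m) Λ q R B)
    (hw : ‖w‖ ≤ ρ * coeffBound (L * m) Λ q B) :
    predError D f w
      ≤ (24 * A + 5.26 + 4.3 * ρ ^ 2) / 16 * targetError (L * m) Λ q R B := by
  have hd : 0 < L * m := by omega
  have hd0 : (0 : ℝ) < ((L * m : ℕ) : ℝ) := by exact_mod_cast hd
  have hΛ0 : (0 : ℝ) < Λ := by exact_mod_cast hΛ
  set ε : ℝ := targetError (L * m) Λ q R B with hε
  have hε0 : 0 ≤ ε := by rw [hε, targetError]; positivity
  set s : ℝ := featureScale (L * m) Λ q B with hs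
  have hs0 : 0 < s := featureScale_pos hΛ hd hB
  have hW0 : 0 < coeffBound (L * m) Λ q B := coeffBound_pos hΛ hd hB
  set t : ℝ := ((L * m : ℕ) : ℝ) / Λ with ht
  have ht1 : 1 ≤ t := (one_le_div hΛ0).2 (by exact_mod_cast hΛd)
  have hte : ∀ z : ℝ, ((L * m : ℕ) : ℝ) * z / Λ = t * z := fun z => by rw [ht]; ring
  obtain ⟨hn0, hfac⟩ := one_add_sqrt_div_sqrt_le (by positivity) hδ hδ2 hn
  have hqe : q < 1 / Real.exp 1 := lt_of_le_of_lt (by nlinarith) hqR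
  -- the comparison of the deviation with the target error
  set T : ℝ := (t * Real.exp 1) ^ Λ with hT
  set G : ℝ := √((t * Real.exp (2 * q ^ 2)) ^ Λ) * √T with hG
  have hG0 : 0 ≤ G := by positivity
  have hGT : G ≤ 0.7 * T := sqrt_mul_sqrt_le hΛ (by linarith) hq0 hqe
  have h1T : 1 ≤ 0.368 * T := one_le_mul_pow hΛ ht1
  have hK : augBound (L * m) Λ q B = B ^ 2 * (1 + G) := by rw [augBound, hte, hte]
  have hεT : ε = 16 * B ^ 2 * (T ^ 2 * (q * (1 + R)) ^ (2 * Λ)) := by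
    have : ((L * m : ℕ) : ℝ) * Real.exp 1 * q * (1 + R) / Λ = t * Real.exp 1 * (q * (1 + R)) := by
      rw [ht]; ring
    rw [hε, targetError, this, mul_pow _ (q * (1 + R)), hT, ← pow_mul, mul_comm Λ 2]
  have hu : ∑ j, augWeight s w j ^ 2 ≤ 1 + ρ ^ 2 * G := by
    rw [sum_augWeight_sq, featureScale_sq hB, hte]
    have hT0 : 0 < √T := Real.sqrt_pos.2 (by positivity)
    have h1 : ‖w‖ ^ 2 ≤ ρ ^ 2 * coeffBound (L * m) Λ q B ^ 2 := by
      rw [← mul_pow]; exact pow_le_pow_left₀ (norm_nonneg w) hw 2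
    have h2 : ρ ^ 2 * coeffBound (L * m) Λ q B ^ 2 / (B * coeffBound (L * m) Λ q B / √T)
        = ρ ^ 2 * G := by
      have : coeffBound (L * m) Λ q B = B * √((t * Real.exp (2 * q ^ 2)) ^ Λ) := by
        rw [coeffBound, hte]
      rw [hG, ← mul_assoc]
      field_simp
      rw [this]
      ring
    have h3 : ‖w‖ ^ 2 / (B * coeffBound (L * m) Λ q B / √T)
        ≤ ρ ^ 2 * coeffBound (L * m) Λ q B ^ 2 / (B * coeffBound (L * m) Λ q B / √T) := by gcongr
    rw [h2] at h3
    linarith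
  have hgap : devForm D (augFeature s f) x (augWeight s w) ≤ (4.3 * ρ ^ 2 + 2.26) / 16 * ε := by
    calc devForm D (augFeature s f) x (augWeight s w)
        ≤ (∑ j, augWeight s w j ^ 2) * supDev D (augFeature s f) x := devForm_le_mul_supDev _ _
      _ ≤ (1 + ρ ^ 2 * G) * (B ^ 2 * (1 + G) * (5.75 * (q * (1 + R)) ^ (2 * Λ))) := by
          refine mul_le_mul hu (hdev.trans ?_) (supDev_nonneg _) (by positivity)
          rw [hK, mul_div_assoc]
          gcongr
      _ ≤ ((0.368 + 0.7 * ρ ^ 2) * T) * (B ^ 2 * (1.068 * T) *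
            (5.75 * (q * (1 + R)) ^ (2 * Λ))) := by
          have h1 : 1 + ρ ^ 2 * G ≤ (0.368 + 0.7 * ρ ^ 2) * T := by
            have := mul_le_mul_of_nonneg_left hGT (sq_nonneg ρ)
            linarith
          have h2 : 1 + G ≤ 1.068 * T := by linarith
          gcongr
      _ = 5.75 * 1.068 * (0.368 + 0.7 * ρ ^ 2) / 16 * ε := by rw [hεT]; ring
      _ ≤ (4.3 * ρ ^ 2 + 2.26) / 16 * ε := by
          refine mul_le_mul_of_nonneg_right ?_ hε0
          nlinarith [sq_nonneg ρ]
  rw [devForm_eq D (continuous_augFeature s hfc)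
    (sum_augFeature_sq_le hΛ hΛd hB hf)] at hgap
  simp only [sqForm_augFeature hs0.ne'] at hgap
  -- the empirical error relative to `f`, from the one relative to the labels
  have hemp : 1 / (n : ℝ) * ∑ i, (hyp w (x i) - f (x i)) ^ 2 ≤ 1.5 * (A * ε) + 3 * (ε / 16) := by
    have h1 : ∀ i, (hyp w (x i) - f (x i)) ^ 2 - 1.5 * (hyp w (x i) - y i) ^ 2 ≤ 3 * (ε / 16) := by
      intro i
      have h2 : (y i - f (x i)) ^ 2 ≤ ε / 16 := by
        have h3 := pow_le_pow_left₀ (abs_nonneg _) (hy i) 2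
        rw [sq_abs, div_pow, Real.sq_sqrt hε0] at h3
        linarith
      -- `(a + b) ^ 2 ≤ 1.5 a ^ 2 + 3 b ^ 2`
      nlinarith [sq_nonneg (hyp w (x i) - y i - 2 * (y i - f (x i)))]
    have h2 := mean_le_of_forall_le hn0 h1
    rw [Finset.sum_sub_distrib, mul_sub, ← Finset.mul_sum] at h2
    have h3 : 1 / (n : ℝ) * (1.5 * ∑ i, (hyp w (x i) - y i) ^ 2) = 1.5 * trainError x y w := by
      rw [trainError]; ring
    rw [h3] at h2
    linarith
  have hpred : predError D f w = ∫ z, (hyp w z - f z) ^ 2 ∂D := by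
    simp only [predError, sq_abs]
  rw [hpred]
  linarith

end Generalization

/-! ### The two forms of the regression -/

section Regression
variable {N L m Λ n : ℕ} {pX pY pZ q R B : ℝ} {ρ₀ O : Op N}

theorem sqrt_targetError (hB : 0 ≤ B) (hq : 0 ≤ q) (hR : 0 ≤ R) (d : ℕ) :
    √(targetError d Λ q R B) = 4 * (B * (d * Real.exp 1 * q * (1 + R) / Λ) ^ Λ) := by
  rw [Real.sqrt_eq_iff_mul_self_eq (by unfold targetError; positivity) (by positivity),
    targetError, mul_comm 2 Λ, pow_mul]
  ring

/-- The training error of the truncated expansion of a function known up to `√ε / 8`. -/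
theorem trainError_le_of_approx {f : (Fin m → ℝ) → ℝ} {α : EuclideanSpace ℝ (Freq (L * m) Λ)}
    {x : Fin n → Fin m → ℝ} {y : Fin n → ℝ} {ε : ℝ} (hn : 0 < n) (hε : 0 ≤ ε)
    (hα : ∀ i, |f (x i) - hyp α (x i)| ≤ √ε / 8) (hy : ∀ i, |y i - f (x i)| ≤ √ε / 4) :
    trainError x y α ≤ 9 / 64 * ε := by
  refine mean_le_of_forall_le hn fun i => ?_
  have h1 : |hyp α (x i) - y i| ≤ 3 / 8 * √ε := by
    rw [abs_sub_comm]
    calc |y i - hyp α (x i)| = |(y i - f (x i)) + (f (x i) - hyp α (x i))| := by ring_nf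
      _ ≤ |y i - f (x i)| + |f (x i) - hyp α (x i)| := abs_add_le _ _
      _ ≤ 3 / 8 * √ε := by linarith [hα i, hy i]
  have h2 := pow_le_pow_left₀ (abs_nonneg _) h1 2
  rw [sq_abs, mul_pow, Real.sq_sqrt hε] at h2
  linarith

theorem IsPenalizedSolution.eq_zero {lam : ℝ} (hlam : 0 < lam) {x : Fin n → Fin m → ℝ}
    {y : Fin n → ℝ} (hy : ∀ i, y i = 0) {w : EuclideanSpace ℝ (Freq (L * m) Λ)}
    (hw : IsPenalizedSolution lam x y w) : w = 0 := by
  have h1 := hw 0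
  have h2 : trainError x y (0 : EuclideanSpace ℝ (Freq (L * m) Λ)) = 0 := by
    simp [trainError, hyp, hy]
  rw [h2, norm_zero, mul_zero, add_zero] at h1
  have h3 := trainError_nonneg x y w
  have h4 : lam * ‖w‖ ≤ 0 := by linarith
  exact norm_le_zero_iff.1 (nonpos_of_mul_nonpos_right h4 hlam)

theorem predError_zero {D : Measure (Fin m → ℝ)} {f : (Fin m → ℝ) → ℝ} (hf : ∀ x, f x = 0) :
    predError D f (0 : EuclideanSpace ℝ (Freq (L * m) Λ)) = 0 := by
  simp [predError, hyp, hf]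

/-- The penalty `ε / (4 W)`, with `W` the bound on the coefficient vector. With it, the objective
value of the truncated expansion is at most `9 ε / 64 + ε / 4`. -/
noncomputable def penalty (d Λ : ℕ) (q R B : ℝ) : ℝ :=
  targetError d Λ q R B / (4 * coeffBound d Λ q B)

theorem targetError_pos {d : ℕ} (hΛ : 0 < Λ) (hd : 0 < d) (hB : 0 < B) (hq : 0 < q) (hR : 0 ≤ R) :
    0 < targetError d Λ q R B := by
  unfold targetError; positivity

theorem IsPenalizedSolution.trainError_le {x : Fin n → Fin m → ℝ} {y : Fin n → ℝ}
    {α w : EuclideanSpace ℝ (Freq (L * m) Λ)}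
    (hW : 0 < coeffBound (L * m) Λ q B) (hε : 0 < targetError (L * m) Λ q R B)
    (hα : trainError x y α ≤ 9 / 64 * targetError (L * m) Λ q R B)
    (hαW : ‖α‖ ≤ coeffBound (L * m) Λ q B)
    (hw : IsPenalizedSolution (penalty (L * m) Λ q R B) x y w) :
    trainError x y w
      ≤ (25 - 16 * (‖w‖ / coeffBound (L * m) Λ q B)) / 64 * targetError (L * m) Λ q R B := by
  set W := coeffBound (L * m) Λ q B
  set ε := targetError (L * m) Λ q R B with hεdef
  have h1 := hw α
  have h2 : penalty (L * m) Λ q R B * ‖α‖ ≤ ε / 4 := by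
    calc penalty (L * m) Λ q R B * ‖α‖ ≤ ε / (4 * W) * W := by unfold penalty; gcongr
      _ = ε / 4 := by field_simp
  have h3 : penalty (L * m) Λ q R B * ‖w‖ = ε / 4 * (‖w‖ / W) := by
    rw [show penalty (L * m) Λ q R B = ε / (4 * W) from rfl]; field_simp
  rw [h3] at h1
  linarith

end Regression
end NoisyPQC

theorem theorem2
    -- `L` layers of `m` rotation gates, so `d = L * m`; truncation threshold `Λ`
    (d L m Λ : ℕ) (hd : d = L * m)
    -- noise parameters, range of the inputs, bound on the observable
    (pX pY pZ q R B : ℝ) (hpX : 0 ≤ pX) (hpY : 0 ≤ pY) (hpZ : 0 ≤ pZ)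
    -- `q_X + q_Y ≥ 0`, which says that `|q_X|, |q_Y| ≤ q`; it contains `pX + pY + pZ ≤ 1`
    (hp : pX + pY + 2 * pZ ≤ 1)
    (hq : q = 1 - 2 * (min pX pY + pZ)) (hq0 : 0 < q)
    (hR : 0 < R) (hqR : q * (1 + R) < 1 / Real.exp 1)
    (hΛ : d * Real.exp 1 * q * (1 + R) < Λ) (hΛd : Λ ≤ d) :
    ∃ lam : ℝ, 0 < lam ∧
      ∀ (N : ℕ) (C : Circuit N (L * m)) (ρ₀ O : Op N),
        IsState ρ₀ → O.IsHermitian → ‖Matrix.toEuclideanCLM (𝕜 := ℂ) O‖ ≤ B →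
      -- an arbitrary input distribution on `[-R, R]^m`
      ∀ (D : Measure (Fin m → ℝ)) [IsProbabilityMeasure D],
        (∀ᵐ x ∂D, ∀ j, x j ∈ Set.Icc (-R) R) →
      -- confidence, number of examples, label accuracy
      ∀ (δ : ℝ) (n : ℕ) (εl : ℝ), 0 < δ → δ ≤ 1 / 2 →
        (1 / (q * (1 + R))) ^ (4 * Λ) * (Real.log (1 / δ) / 9) ≤ n →
        εl ≤ √(targetError d Λ q R B) / 4 →
      -- the random training set: independent inputs from `D`, labels accurate to `εl`
      ∀ (Ω : Type*) [MeasurableSpace Ω] (μ : Measure Ω) [IsProbabilityMeasure μ]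
        (X : Fin n → Ω → Fin m → ℝ) (Y : Fin n → Ω → ℝ),
        iIndepFun X μ → (∀ i, HasLaw (X i) D μ) →
        (∀ᵐ s ∂μ, ∀ i, |Y i s - C.meanValue pX pY pZ ρ₀ O (X i s)| ≤ εl) →
      -- failure has (outer) probability at most `δ`, for the penalized form of the regression
      μ {s | ∃ w : EuclideanSpace ℝ (Freq (L * m) Λ),
            IsPenalizedSolution lam (fun i => X i s) (fun i => Y i s) w ∧
            targetError d Λ q R B < predError D (C.meanValue pX pY pZ ρ₀ O) w}
          ≤ ENNReal.ofReal δ ∧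
      -- and for its norm-constrained form
      ∀ r : ℝ, truncCoeffNorm C pX pY pZ ρ₀ O Λ ≤ r →
        r ≤ B * √((d * Real.exp (2 * q ^ 2) / Λ) ^ Λ) →
        μ {s | ∃ w : EuclideanSpace ℝ (Freq (L * m) Λ),
            IsConstrainedSolution r (fun i => X i s) (fun i => Y i s) w ∧
            targetError d Λ q R B < predError D (C.meanValue pX pY pZ ρ₀ O) w}
          ≤ ENNReal.ofReal δ := by
  subst hd
  have hΛ1 : 1 ≤ Λ := by
    have h0 : (0 : ℝ) < Λ := lt_of_le_of_lt (by positivity) hΛ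
    exact_mod_cast h0
  have hd : 0 < L * m := by omega
  have hp1 : pX + pY + pZ ≤ 1 := by linarith
  rcases le_or_gt B 0 with hB | hB
  · -- the observable vanishes, and with it the labels and both minimizers
    refine ⟨1, one_pos, fun N C ρ₀ O hρ _ hO D _ _ δ n εl hδ _ _ hεl Ω _ μ _ X Y _ _ hY => ?_⟩
    have hB0 : B = 0 := le_antisymm hB ((norm_nonneg _).trans hO)
    subst hB0
    have hf : ∀ x, C.meanValue pX pY pZ ρ₀ O x = 0 := fun x =>
      abs_nonpos_iff.1 (C.abs_meanValue_le hpX hpY hpZ hp1 hρ hO x)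
    have hε : targetError (L * m) Λ q R 0 = 0 := by simp [targetError]
    rw [hε, Real.sqrt_zero, zero_div] at hεl
    refine ⟨?_, fun r _ hr => ?_⟩
    · refine le_trans (le_of_eq (measure_eq_zero_iff_ae_notMem.2 ?_)) zero_le
      filter_upwards [hY] with s hs
      rintro ⟨w, hw, hlt⟩
      have hy : ∀ i, Y i s = 0 := fun i => by
        have := (hs i).trans hεl
        rwa [hf, sub_zero, abs_nonpos_iff] at this
      rw [hw.eq_zero one_pos hy, hε, predError_zero hf] at hlt
      exact lt_irrefl _ hlt
    · refine le_trans (le_of_eq (measure_eq_zero_iff_ae_notMem.2 (ae_of_all _ fun s => ?_))) zero_le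
      rintro ⟨w, hw, hlt⟩
      rw [zero_mul] at hr
      rw [norm_le_zero_iff.1 (hw.1.trans hr), hε, predError_zero hf] at hlt
      exact lt_irrefl _ hlt
  · have hW : 0 < coeffBound (L * m) Λ q B := coeffBound_pos hΛ1 hd hB
    have hε : 0 < targetError (L * m) Λ q R B := targetError_pos hΛ1 hd hB hq0 hR.le
    refine ⟨penalty (L * m) Λ q R B, by unfold penalty; positivity,
      fun N C ρ₀ O hρ _ hO D _ hD δ n εl hδ hδ2 hn hεl Ω _ μ _ X Y hind hX hY => ?_⟩
    set f : (Fin m → ℝ) → ℝ := C.meanValue pX pY pZ ρ₀ O with hfdef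
    have hf : ∀ x, |f x| ≤ B := C.abs_meanValue_le hpX hpY hpZ hp1 hρ hO
    have hfc : Continuous f := C.continuous_meanValue pX pY pZ ρ₀ O
    set α : EuclideanSpace ℝ (Freq (L * m) Λ) := C.truncCoeff pX pY pZ ρ₀ O Λ with hα
    have hαW : ‖α‖ ≤ coeffBound (L * m) Λ q B :=
      C.truncCoeffNorm_le hΛ1 hΛd hpX hpY hpZ hp hq hq0.le hρ hO
    have hn0 : 0 < n := (one_add_sqrt_div_sqrt_le (by positivity) hδ hδ2 hn).1
    set ψ : (Fin m → ℝ) → Option (Freq (L * m) Λ) → ℝ :=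
      augFeature (featureScale (L * m) Λ q B) f with hψ
    set thr : ℝ := augBound (L * m) Λ q B * (1 + √(Real.log (1 / δ) / 2)) / √n with hthr
    have hψc : Continuous ψ := continuous_augFeature _ hfc
    have hψK : ∀ z, ∑ j, ψ z j ^ 2 ≤ augBound (L * m) Λ q B :=
      sum_augFeature_sq_le hΛ1 hΛd hB hf
    have hK0 : 0 < augBound (L * m) Λ q B := by unfold augBound; positivity
    -- the event of a large uniform deviation, transported from the product measure
    have hbad : μ {s | thr < supDev D ψ fun i => X i s} ≤ ENNReal.ofReal δ := by
      have hXm : ∀ i, AEMeasurable (X i) μ := fun i => (hX i).aemeasurable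
      have hmap : μ.map (fun s i => X i s) = Measure.pi fun _ => D := by
        rw [hind.map_fun_eq_pi_map hXm]
        simp only [(hX _).map_eq]
      have hmeas : MeasurableSet {x : Fin n → Fin m → ℝ | thr < supDev D ψ x} :=
        measurableSet_lt measurable_const (continuous_supDev D hψc).measurable
      have := measure_supDev_gt_le (n := n) D hψc hψK hn0 hK0 hδ (by linarith)
      rwa [← hmap, Measure.map_apply_of_aemeasurable (aemeasurable_pi_lambda _ hXm) hmeas] at this
    have hXR : ∀ᵐ s ∂μ, ∀ i, ∀ j, X i s j ∈ Set.Icc (-R) R := by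
      refine ae_all_iff.2 fun i => ae_of_ae_map
        (p := fun x : Fin m → ℝ => ∀ j, x j ∈ Set.Icc (-R) R) (hX i).aemeasurable ?_
      rw [(hX i).map_eq]; exact hD
    -- almost surely the training data satisfy the deterministic assumptions
    have hdata : ∀ᵐ s ∂μ, (∀ i, |Y i s - f (X i s)| ≤ √(targetError (L * m) Λ q R B) / 4) ∧
        trainError (fun i => X i s) (fun i => Y i s) α ≤ 9 / 64 * targetError (L * m) Λ q R B := by
      filter_upwards [hY, hXR] with s hs hsR
      have hy : ∀ i, |Y i s - f (X i s)| ≤ √(targetError (L * m) Λ q R B) / 4 :=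
        fun i => (hs i).trans hεl
      refine ⟨hy, trainError_le_of_approx hn0 hε.le (fun i => ?_) hy⟩
      refine (C.abs_meanValue_sub_hyp_truncCoeff_le hΛ1 hpX hpY hpZ hp hq hq0 hR.le hd hΛ.le hρ hO
        (hsR i)).trans (le_of_eq ?_)
      rw [sqrt_targetError hB.le hq0.le hR.le]
      ring
    refine ⟨le_trans (measure_mono_ae ?_) hbad, fun r hαr hrW => le_trans (measure_mono_ae ?_) hbad⟩
    · filter_upwards [hdata] with s hs
      rintro ⟨w, hw, hlt⟩
      by_contra hdev
      have htrain := hw.trainError_le hW hε hs.2 hαW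
      set ρ : ℝ := ‖w‖ / coeffBound (L * m) Λ q B with hρdef
      have hρ0 : 0 ≤ ρ := by positivity
      have hpred := predError_le_of_supDev_le D hfc hf hB hΛ1 hΛd hq0 hR.le hqR hδ hδ2 hn hs.1
        (not_lt.1 hdev) htrain (ρ := ρ) (le_of_eq (by rw [hρdef]; field_simp))
      have hρ1 : ρ ≤ 25 / 16 := by
        have h1 := (trainError_nonneg _ _ _).trans htrain
        have h2 := nonneg_of_mul_nonneg_left h1 hε
        linarith
      -- the left side is convex in `ρ`, and below one at both ends of `[0, 25 / 16]`
      have hnum : (24 * ((25 - 16 * ρ) / 64) + 5.26 + 4.3 * ρ ^ 2) / 16 ≤ 1 := by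
        nlinarith
      exact absurd (hpred.trans (mul_le_of_le_one_left hε.le hnum)) (not_le.2 hlt)
    · filter_upwards [hdata] with s hs
      rintro ⟨w, hw, hlt⟩
      by_contra hdev
      have htrain := (hw.2 α hαr).trans hs.2
      have hpred := predError_le_of_supDev_le D hfc hf hB hΛ1 hΛd hq0 hR.le hqR hδ hδ2 hn hs.1
        (not_lt.1 hdev) htrain (ρ := 1) (by rw [one_mul]; exact hw.1.trans hrW)
      have hnum : (24 * (9 / 64) + 5.26 + 4.3 * 1 ^ 2 : ℝ) / 16 ≤ 1 := by norm_num
      exact absurd (hpred.trans (mul_le_of_le_one_left hε.le hnum)) (not_le.2 hlt)
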